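/- Let $p$ be a prime, let $q=p^k$ with $k\ge 1$, and let $r$ be an odd prime not dividing $q$ such that $q$ is a primitive root modulo $r$. Let $\Phi_r(x)=x^{r-1}+\dots+x+1$, and let $\mathbb F_q(\theta)=\mathbb F_{q^{r-1}}=\mathbb F_q[x]/(\Phi_r(x))$, where $\theta$ is the class of $x$ (so $\theta^r=1$). Suppose that $r-3\ge 2p^2$. Let $e$ be any integer, $f$ any integer coprime to $r$, and $a\in\mathbb F_q$ any non-zero element. For a non-zero integer $n$ let $\rho_2(n)$ denote the highest power of $2$ dividing $n$. Then: (a) the multiplicative order of $\theta^e(\theta^f+a)$ is larger than $$\left(\frac{p(p-1)}{160(r-2)}\right)^{\sqrt p}\exp\left(2.5\sqrt{\left(1-\frac1p\right)(r-2)}\right);$$ (b) if $a\ne 1,-1$, then the multiplicative order of $\theta^e(\theta^f+a)$ is larger than $$\frac12\left(\frac{p(p-1)}{80(r-3)}\right)^{2\sqrt p}\exp\left(2.5\sqrt2\sqrt{\left(1-\frac1p\right)(r-3)}\right);$$ (c) if $a\ne 1,-1$ and $p$ is odd (so that exactly one of the two cases below occurs), then the element $$z=\begin{cases}(\theta+\theta^{-1})^2(a\theta+1)(\theta+a)^{-1}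 & \text{if }\rho_2(q^{(r-1)/2}-1)=2,\\ (\theta+\theta^{-1})\left[(a\theta+1)(\theta+a)^{-1}\right]^2 & \text{if }\rho_2(q^{(r-1)/2}+1)=2\end{cases}$$ has multiplicative order larger than $$\frac12\left(\frac{p(p-1)}{80(r-3)}\right)^{\sqrt p}\exp\left(2.5\left(1+\frac{\sqrt2}{2}\right)\sqrt{\left(1-\frac1p\right)(r-3)}\right).$$ -/

import Mathlib

/-- `rhoTwo n` is the highest power of `2` dividing the (nonzero) integer `n`. -/
def rhoTwo (n : ℤ) : ℕ := 2 ^ padicValInt 2 n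

/-! Put `ζ = θ ^ f`, again a primitive `r`-th root of unity, and `γ = ζ ^ E * (ζ + a)`. Since `q`
generates the units mod `r`, some iterate of the `q`-Frobenius sends `ζ` to `ζ ^ j` for each `j`
prime to `r`. Frobenius iterates are power maps, so every conjugate `ζ ^ (E * j) * (ζ ^ j + a)` is a
power of `γ`, and so is every product of these with integer exponents. The order of `γ` is at least
the number of distinct such products (`card_le_orderOf`).

Distinctness comes from a degree bound. As `Φ_r` is irreducible over `F`, no non-zero polynomial of
degree at most `r - 2` kills `ζ`. Two equal products of small weighted degree therefore give an
identity between polynomials in the factors `X ^ n + a` and, when `a ≠ a⁻¹`, `X ^ n + a⁻¹`. For `n`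
prime to `p` these factors are multiplicatively independent (`exponents_eq_zero`), because over the
algebraic closure `X ^ n + a` has a root shared with no other factor of smaller or equal `n`
(`exists_separating_root`).

It remains to count exponent vectors. Integer vectors in a weighted `ℓ¹`-ball are at least as many
as the volume of the cross-polytope (`card_weightedBall_ge`). Fixing the weighted sum makes the
power of `ζ` constant and halves the degree of a difference, at the cost of a factor `2 * m + 1`.
With `n` running over the integers prime to `p` and about `√(2m(1 - 1/p))` coordinates, Stirling
gives growth `exp (2√(2m(1 - 1/p)))` up to polynomial factors. These are absorbed by the smaller
exponential constants and the prefactor of the bounds.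

(a) uses one slice with `m = r - 2`. (b) uses pairs from a slice with `m = (r - 3) / 2`, the second
vector carrying the factors with `a⁻¹`, obtained from `ζ ^ (-j) + a`. (c) multiplies an element of
order dividing `N - 1` by one of order dividing `N + 1`, where `N = q ^ ((r - 1) / 2)`; squaring one
of them makes the orders coprime. -/

/-! ### Counting lattice points in weighted `ℓ¹`-balls. -/

/-- Integer vectors of length `k` whose weighted `ℓ¹`-norm, with weights `a 0, a 1, …`, is at most
`m`. -/
noncomputable def weightedBall (a : ℕ → ℕ) (k m : ℕ) : Finset (Fin k → ℤ) :=
  (Fintype.piFinset fun _ : Fin k => Finset.Icc (-(m : ℤ)) m).filter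
    fun W => ∑ i : Fin k, (a i : ℤ) * |W i| ≤ m

theorem mem_weightedBall {a : ℕ → ℕ} (ha : ∀ i, 0 < a i) {k m : ℕ} {W : Fin k → ℤ} :
    W ∈ weightedBall a k m ↔ ∑ i : Fin k, (a i : ℤ) * |W i| ≤ m := by
  simp only [weightedBall, Finset.mem_filter, Fintype.mem_piFinset, Finset.mem_Icc,
    and_iff_right_iff_imp]
  intro h i
  have h1 : (a i : ℤ) * |W i| ≤ m :=
    (Finset.single_le_sum (f := fun i : Fin k => (a i : ℤ) * |W i|)
      (fun _ _ => by positivity) (Finset.mem_univ i)).trans h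
  have h2 : (1 : ℤ) ≤ a i := by exact_mod_cast ha i
  have h3 : |W i| ≤ m := by nlinarith [abs_nonneg (W i)]
  exact abs_le.mp h3

/-- Cutting the ball by its last coordinate `w` leaves balls of radius `m - a k * |w|` one dimension
lower. -/
theorem sum_card_weightedBall_le {a : ℕ → ℕ} (ha : ∀ i, 0 < a i) (k m : ℕ) :
    ∑ w ∈ Finset.Icc (-((m / a k : ℕ) : ℤ)) ((m / a k : ℕ) : ℤ),
      (weightedBall a k (m - a k * w.natAbs)).card ≤ (weightedBall a (k + 1) m).card := by
  rw [← Finset.card_sigma]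
  refine Finset.card_le_card_of_injOn (fun x => Fin.snoc (α := fun _ => ℤ) x.2 x.1) ?_ ?_
  · rintro ⟨w, W⟩ hx
    simp only [Finset.coe_sigma, Set.mem_sigma_iff, Finset.mem_coe, Finset.mem_Icc,
      mem_weightedBall ha] at hx ⊢
    obtain ⟨⟨h1, h2⟩, h3⟩ := hx
    have h4 : w.natAbs ≤ m / a k := by omega
    have h5 : a k * w.natAbs ≤ m := by
      rw [mul_comm]; exact (Nat.le_div_iff_mul_le (ha k)).mp h4
    rw [Fin.sum_univ_castSucc]
    simp only [Fin.snoc_castSucc, Fin.snoc_last, Fin.val_castSucc, Fin.val_last]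
    push_cast [h5] at h3
    linarith
  · rintro ⟨w, W⟩ - ⟨w', W'⟩ - h
    have h' := Fin.snoc_injective2 (α := fun _ : Fin (k + 1) => ℤ) h
    obtain ⟨rfl, rfl⟩ := h'
    rfl

/-- The trapezoid rule overestimates the integral of the convex function `t ^ k` over `[y, x]`.
Algebraically, symmetric terms of the geometric sum pair up, each pair being at most `x ^ k + y ^
k`. -/
theorem pow_succ_sub_pow_succ_le {x y : ℝ} (hy : 0 ≤ y) (hxy : y ≤ x) (k : ℕ) :
    2 * (x ^ (k + 1) - y ^ (k + 1)) ≤ (k + 1) * (x - y) * (x ^ k + y ^ k) := by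
  have hx : 0 ≤ x := hy.trans hxy
  have h1 : ∀ i ∈ Finset.range (k + 1),
      x ^ i * y ^ (k - i) + x ^ (k - i) * y ^ i ≤ x ^ k + y ^ k := by
    intro i hi
    have hik : i ≤ k := by simpa [Nat.lt_succ_iff] using hi
    have e1 : x ^ k = x ^ i * x ^ (k - i) := by rw [← pow_add]; congr 1; omega
    have e2 : y ^ k = y ^ i * y ^ (k - i) := by rw [← pow_add]; congr 1; omega
    rw [e1, e2]
    have := mul_nonneg (sub_nonneg.mpr (pow_le_pow_left₀ hy hxy i))
      (sub_nonneg.mpr (pow_le_pow_left₀ hy hxy (k - i)))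
    nlinarith
  have h2 := (Commute.all x y).geom_sum₂_mul (n := k + 1)
  have h3 : ∑ i ∈ Finset.range (k + 1), x ^ i * y ^ (k - i)
      = ∑ i ∈ Finset.range (k + 1), x ^ (k - i) * y ^ i := by
    rw [← Finset.sum_range_reflect]
    refine Finset.sum_congr rfl fun i hi => ?_
    have hik : i ≤ k := by simpa [Nat.lt_succ_iff] using hi
    congr 2; omega
  have h4 := Finset.sum_le_sum h1
  rw [Finset.sum_add_distrib, ← h3, Finset.sum_const, Finset.card_range, nsmul_eq_mul] at h4
  rw [← h2]
  simp only [Nat.add_sub_cancel]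
  push_cast at h4
  nlinarith [mul_le_mul_of_nonneg_left h4 (sub_nonneg.mpr hxy)]

theorem trapezoid_sum_ge {α : ℝ} {m : ℝ} (hα : 0 < α) (k N : ℕ) (hN : α * N ≤ m) :
    2 * (m ^ (k + 1) - (m - α * N) ^ (k + 1)) ≤
      (k + 1) * α * (∑ i ∈ Finset.range N, ((m - α * i) ^ k + (m - α * (i + 1 : ℕ)) ^ k)) := by
  induction N with
  | zero => simp
  | succ N ih =>
    push_cast at hN
    have h1 := ih (by nlinarith)
    have h2 := pow_succ_sub_pow_succ_le (x := m - α * N) (y := m - α * (N + 1 : ℕ))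
      (by push_cast; linarith) (by push_cast; linarith) k
    rw [Finset.sum_range_succ, mul_add]
    have h3 : m - α * N - (m - α * (N + 1 : ℕ)) = α := by push_cast; ring
    rw [h3] at h2
    linarith

/-- The right-hand factor is the one turning the volume `(2m)^(k+1) / ((k+1)! ∏ a i)` of the real
ball into a lower bound for its lattice points. Induct on the dimension by slicing: the sum over
slices dominates the integral of their volumes by the trapezoid rule. `a 0 = 1` is what makes
dimension one work. -/
theorem card_weightedBall_ge {a : ℕ → ℕ} (ha : ∀ i, 0 < a i) (ha0 : a 0 = 1) (k m : ℕ) :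
    (2 * (m : ℝ)) ^ (k + 1) ≤ ((k + 1).factorial * ∏ i ∈ Finset.range (k + 1), (a i : ℝ)) *
      (weightedBall a (k + 1) m).card := by
  induction k generalizing m with
  | zero =>
    have h := sum_card_weightedBall_le ha 0 m
    have h0 : ∀ n, 1 ≤ (weightedBall a 0 n).card := fun n =>
      Finset.card_pos.mpr ⟨0, (mem_weightedBall ha).mpr (by simp)⟩
    have h1 : 2 * m + 1 ≤ (weightedBall a 1 m).card := by
      refine le_trans ?_ h
      calc 2 * m + 1 = ∑ w ∈ Finset.Icc (-((m / a 0 : ℕ) : ℤ)) ((m / a 0 : ℕ) : ℤ), 1 := by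
            rw [Finset.sum_const, Int.card_Icc, ha0]; simp; omega
        _ ≤ _ := Finset.sum_le_sum fun _ _ => h0 _
    have h2 : (2 * (m : ℝ) + 1) ≤ (weightedBall a 1 m).card := by exact_mod_cast h1
    simp [ha0]
    linarith
  | succ k ih =>
    have hα : (0 : ℝ) < a (k + 1) := by exact_mod_cast ha (k + 1)
    set N := m / a (k + 1) with hNdef
    have hN : a (k + 1) * N ≤ m := Nat.mul_div_le _ _
    have hN' : m < a (k + 1) * (N + 1) := by
      rw [mul_comm]; exact Nat.lt_mul_of_div_lt (Nat.lt_succ_self _) (ha _)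
    have h := sum_card_weightedBall_le ha (k + 1) m
    set P : ℝ := (k + 1).factorial * ∏ i ∈ Finset.range (k + 1), (a i : ℝ) with hP
    have hP0 : 0 < P := by
      have : ∀ i ∈ Finset.range (k + 1), (0 : ℝ) < a i := fun i _ => by exact_mod_cast ha i
      have := Finset.prod_pos this
      positivity
    have hsum : (∑ w ∈ Finset.Icc (-(N : ℤ)) (N : ℤ),
        (2 * ((m : ℝ) - a (k + 1) * (w.natAbs : ℝ))) ^ (k + 1)) ≤
          P * (weightedBall a (k + 2) m).card := by
      refine le_trans ?_ (mul_le_mul_of_nonneg_left (Nat.cast_le.mpr h) hP0.le)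
      push_cast
      rw [Finset.mul_sum]
      refine Finset.sum_le_sum fun w hw => ?_
      rw [Finset.mem_Icc] at hw
      have h4 : w.natAbs ≤ N := by omega
      have h5 : a (k + 1) * w.natAbs ≤ m := (Nat.mul_le_mul_left _ h4).trans hN
      have := ih (m - a (k + 1) * w.natAbs)
      push_cast [h5] at this
      simpa using this
    rw [Finset.sum_Icc_of_even_eq_range (fun x => by simp)] at hsum
    have hN1 : (a (k + 1) : ℝ) * N ≤ m := by exact_mod_cast hN
    have hN2 : (m : ℝ) < a (k + 1) * (N + 1) := by exact_mod_cast hN'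
    have htr := trapezoid_sum_ge (m := m) hα (k + 1) N hN1
    -- The node `N` has only half weight in the trapezoid sum; its other half pays for the leftover
    -- interval of length `m - a (k + 1) * N`, which is shorter than a full step.
    have hlast : 2 * ((m : ℝ) - a (k + 1) * N) ^ (k + 2) ≤
        (k + 2) * a (k + 1) * ((m : ℝ) - a (k + 1) * N) ^ (k + 1) := by
      have h0 : 0 ≤ (m : ℝ) - a (k + 1) * N := by linarith
      rw [pow_succ]
      have := pow_nonneg h0 (k + 1)
      have h6 : 2 * ((m : ℝ) - a (k + 1) * N) ≤ (k + 2) * a (k + 1) := by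
        have : (0 : ℝ) ≤ k := by positivity
        nlinarith
      nlinarith
    have hre : ∑ i ∈ Finset.range N, (((m : ℝ) - a (k + 1) * i) ^ (k + 1) +
          ((m : ℝ) - a (k + 1) * (i + 1 : ℕ)) ^ (k + 1)) +
            ((m : ℝ) - a (k + 1) * N) ^ (k + 1) =
        2 * ∑ i ∈ Finset.range (N + 1), ((m : ℝ) - a (k + 1) * i) ^ (k + 1) - (m : ℝ) ^ (k + 1) := by
      rw [Finset.sum_add_distrib, two_mul]
      have e1 := Finset.sum_range_succ (fun i : ℕ => ((m : ℝ) - a (k + 1) * i) ^ (k + 1)) N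
      have e2 := Finset.sum_range_succ' (fun i : ℕ => ((m : ℝ) - a (k + 1) * i) ^ (k + 1)) N
      simp only [Nat.cast_zero, mul_zero, sub_zero] at e2
      linarith
    have hsum' : 2 ^ (k + 1) * (2 * ∑ i ∈ Finset.range (N + 1),
        ((m : ℝ) - a (k + 1) * i) ^ (k + 1) - (m : ℝ) ^ (k + 1)) ≤
          P * (weightedBall a (k + 2) m).card := by
      refine le_trans (le_of_eq ?_) hsum
      simp only [mul_pow, ← Finset.mul_sum, Int.natAbs_natCast, Int.natAbs_zero, Nat.cast_zero,
        mul_zero, sub_zero, nsmul_eq_mul]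
      push_cast
      ring
    rw [← hre] at hsum'
    have hfin : 2 * (m : ℝ) ^ (k + 2) ≤ (k + 2) * a (k + 1) *
        (∑ i ∈ Finset.range N, (((m : ℝ) - a (k + 1) * i) ^ (k + 1) +
          ((m : ℝ) - a (k + 1) * (i + 1 : ℕ)) ^ (k + 1)) +
            ((m : ℝ) - a (k + 1) * N) ^ (k + 1)) := by
      push_cast at htr ⊢
      linarith
    calc (2 * (m : ℝ)) ^ (k + 1 + 1) = 2 ^ (k + 1) * (2 * (m : ℝ) ^ (k + 2)) := by ring
      _ ≤ 2 ^ (k + 1) * ((k + 2) * a (k + 1) *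
        (∑ i ∈ Finset.range N, (((m : ℝ) - a (k + 1) * i) ^ (k + 1) +
          ((m : ℝ) - a (k + 1) * (i + 1 : ℕ)) ^ (k + 1)) +
            ((m : ℝ) - a (k + 1) * N) ^ (k + 1))) := by gcongr
      _ = ((k + 2) * a (k + 1)) * (2 ^ (k + 1) *
        (∑ i ∈ Finset.range N, (((m : ℝ) - a (k + 1) * i) ^ (k + 1) +
          ((m : ℝ) - a (k + 1) * (i + 1 : ℕ)) ^ (k + 1)) +
            ((m : ℝ) - a (k + 1) * N) ^ (k + 1))) := by ring
      _ ≤ ((k + 2) * a (k + 1)) * (P * (weightedBall a (k + 2) m).card) := by gcongr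
      _ = _ := by
        rw [hP, Finset.prod_range_succ _ (k + 1), Nat.factorial_succ (k + 1)]
        push_cast
        ring

/-! ### Slices of the ball. -/

/-- Vectors of the weighted ball with a prescribed weighted sum. -/
noncomputable def weightedSlice (a : ℕ → ℕ) (k m : ℕ) (s : ℤ) : Finset (Fin k → ℤ) :=
  (weightedBall a k m).filter fun W => ∑ i : Fin k, (a i : ℤ) * W i = s

/-- Pigeonhole: on the ball the weighted sum takes values in `[-m, m]`. -/
theorem exists_card_weightedSlice_ge {a : ℕ → ℕ} (ha : ∀ i, 0 < a i) (k m : ℕ) :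
    ∃ s, ((weightedBall a k m).card : ℝ) / (2 * m + 1) ≤ (weightedSlice a k m s).card := by
  have hmap : ∀ W ∈ weightedBall a k m, (∑ i : Fin k, (a i : ℤ) * W i) ∈ Finset.Icc (-(m : ℤ)) m := by
    intro W hW
    rw [mem_weightedBall ha] at hW
    rw [Finset.mem_Icc, ← abs_le]
    refine (Finset.abs_sum_le_sum_abs _ _).trans (le_trans (le_of_eq ?_) hW)
    simp [abs_mul]
  obtain ⟨s, -, hs⟩ := Finset.exists_le_card_fiber_of_nsmul_le_card_of_maps_to hmap
    (b := ((weightedBall a k m).card : ℝ) / (2 * m + 1)) ⟨0, by simp⟩ (by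
      rw [Int.card_Icc, nsmul_eq_mul]
      have : ((m : ℤ) + 1 - -(m : ℤ)).toNat = 2 * m + 1 := by omega
      rw [this]
      push_cast
      rw [mul_div_cancel₀]
      positivity)
  exact ⟨s, hs⟩

/-! ### Weights: the integers prime to `p`. -/

/-- The increasing enumeration of the positive integers not divisible by `p`. -/
def nonMultiple (p i : ℕ) : ℕ := i + i / (p - 1) + 1

theorem nonMultiple_pos (p i : ℕ) : 0 < nonMultiple p i := Nat.succ_pos _

theorem nonMultiple_zero (p : ℕ) : nonMultiple p 0 = 1 := by simp [nonMultiple]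

theorem nonMultiple_strictMono (p : ℕ) : StrictMono (nonMultiple p) := fun i j h => by
  have := Nat.div_le_div_right (c := p - 1) h.le
  simp only [nonMultiple]
  omega

theorem not_dvd_nonMultiple {p : ℕ} (hp : 2 ≤ p) (i : ℕ) : ¬ p ∣ nonMultiple p i := by
  obtain ⟨d, rfl⟩ : ∃ d, p = d + 1 := ⟨p - 1, by omega⟩
  simp only [nonMultiple, Nat.add_sub_cancel]
  have h1 := Nat.div_add_mod i d
  have h2 := Nat.mod_lt i (show 0 < d by omega)
  have h3 : i + i / d + 1 = (d + 1) * (i / d) + (i % d + 1) := by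
    nth_rewrite 1 [← h1]; ring
  rw [h3, Nat.dvd_add_right (Dvd.intro _ rfl)]
  exact Nat.not_dvd_of_pos_of_lt (by omega) (by omega)

theorem nonMultiple_mul_le {p : ℕ} (hp : 2 ≤ p) (i : ℕ) :
    (p - 1) * nonMultiple p i ≤ p * (i + 1) := by
  obtain ⟨d, rfl⟩ : ∃ d, p = d + 1 := ⟨p - 1, by omega⟩
  simp only [nonMultiple, Nat.add_sub_cancel]
  have := Nat.mul_div_le i d
  nlinarith

theorem nonMultiple_le {p : ℕ} (hp : 2 ≤ p) (i : ℕ) :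
    (1 - 1 / (p : ℝ)) * nonMultiple p i ≤ i + 1 := by
  have h := nonMultiple_mul_le hp i
  have h' : ((p : ℝ) - 1) * nonMultiple p i ≤ p * (i + 1) := by
    have : ((p - 1 : ℕ) : ℝ) = (p : ℝ) - 1 := by push_cast [show 1 ≤ p by omega]; ring
    rw [← this]; exact_mod_cast h
  have hp0 : (0 : ℝ) < p := by positivity
  have e : (1 - 1 / (p : ℝ)) = ((p : ℝ) - 1) / p := by field_simp
  rw [e, div_mul_eq_mul_div, div_le_iff₀ hp0]
  linarith

theorem prod_nonMultiple_le {p : ℕ} (hp : 2 ≤ p) (k : ℕ) :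
    (1 - 1 / (p : ℝ)) ^ k * ∏ i ∈ Finset.range k, (nonMultiple p i : ℝ) ≤ k.factorial := by
  have h0 : 0 ≤ (1 - 1 / (p : ℝ)) := by
    have : (2 : ℝ) ≤ p := by exact_mod_cast hp
    rw [sub_nonneg, div_le_one (by linarith)]; linarith
  rw [← Finset.prod_range_add_one_eq_factorial]
  push_cast
  calc _ = ∏ i ∈ Finset.range k, ((1 - 1 / (p : ℝ)) * nonMultiple p i) := by
        rw [Finset.prod_mul_distrib]; simp
    _ ≤ _ := Finset.prod_le_prod (fun i _ => by positivity) fun i _ => nonMultiple_le hp i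

/-! ### Exponential lower bounds for the balls. -/

/-- The Stirling sequence decreases from its first value `e / √2`. -/
theorem factorial_le_stirling {k : ℕ} (hk : 0 < k) :
    (k.factorial : ℝ) ≤ Real.exp 1 * Real.sqrt k * (k / Real.exp 1) ^ k := by
  obtain ⟨n, rfl⟩ : ∃ n, k = n + 1 := ⟨k - 1, by omega⟩
  have h := Stirling.stirlingSeq'_antitone (Nat.zero_le n)
  simp only [Function.comp, Nat.succ_eq_add_one, zero_add, Stirling.stirlingSeq_one] at h
  rw [Stirling.stirlingSeq, div_le_iff₀ (by positivity)] at h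
  refine h.trans (le_of_eq ?_)
  rw [Real.sqrt_mul (by norm_num)]
  field_simp

/-- The terms `x ^ k / k!` peak near `k = x`, so `k = ⌊x⌋` is the choice; Stirling then leaves `(x /
k) ^ k`, which is nearly `exp (x - k)`. The square appears because both the volume formula and the
product of the weights contribute a `k!`. -/
theorem exp_le_mul_pow_div_factorial {x : ℝ} (hx : 1 ≤ x) :
    Real.exp (2 * x - 2 - 1 / ⌊x⌋₊) / x ≤ (x ^ ⌊x⌋₊ / (⌊x⌋₊).factorial) ^ 2 := by
  set k := ⌊x⌋₊ with hk
  have hk1 : 1 ≤ k := Nat.one_le_floor_iff x |>.mpr hx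
  have hk0 : (0 : ℝ) < k := by exact_mod_cast hk1
  have hkx : (k : ℝ) ≤ x := Nat.floor_le (by linarith)
  have hxk : x < k + 1 := Nat.lt_floor_add_one x
  have hlog : (x - k) - 1 / (2 * k) ≤ k * Real.log (x / k) := by
    -- Uses `log (1 + t) ≥ 2t / (t + 2)` at `t = (x - k) / k`; since `0 ≤ x - k ≤ 1` the loss is at
    -- most `1 / (2k)`.
    have h := Real.le_log_one_add_of_nonneg (x := (x - k) / k)
      (div_nonneg (by linarith) hk0.le)
    have e : 1 + (x - k) / k = x / k := by field_simp; ring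
    rw [e] at h
    refine le_trans ?_ (mul_le_mul_of_nonneg_left h hk0.le)
    have e2 : (k : ℝ) * (2 * ((x - k) / k) / ((x - k) / k + 2)) = 2 * k * (x - k) / (x + k) := by
      have h0 : x + k ≠ 0 := by positivity
      have h1 : (x - k) / k + 2 = (x + k) / k := by field_simp; ring
      rw [h1]
      field_simp
    rw [e2, le_div_iff₀ (by positivity)]
    set δ := x - k with hδ
    have hx' : x = k + δ := by simp [hδ]
    have hδ0 : 0 ≤ δ := by simp [hδ, hkx]
    have hδ1 : δ ≤ 1 := by linarith
    rw [hx']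
    have : 1 / (2 * (k : ℝ)) * (k + δ + k) = 1 + δ / (2 * k) := by field_simp; ring
    have h0 : 0 ≤ δ / (2 * k) := by positivity
    nlinarith
  have hpow : Real.exp ((x - k) - 1 / (2 * k)) ≤ (x / k) ^ k := by
    rw [← Real.exp_log (show 0 < (x / k) ^ k by positivity), Real.log_pow]
    exact Real.exp_le_exp.mpr hlog
  have hst := factorial_le_stirling hk1
  have hbase : Real.exp (x - 1 - 1 / (2 * k)) / Real.sqrt k ≤ x ^ k / k.factorial := by
    calc Real.exp (x - 1 - 1 / (2 * k)) / Real.sqrt k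
        = Real.exp ((x - k) - 1 / (2 * k)) * k ^ k /
            (Real.exp 1 * Real.sqrt k * (k / Real.exp 1) ^ k) := by
          rw [div_pow, ← Real.exp_nat_mul, mul_one,
            show x - 1 - 1 / (2 * (k : ℝ)) = (x - k - 1 / (2 * k)) + k - 1 by ring,
            Real.exp_sub, Real.exp_add]
          field_simp
      _ ≤ (x / k) ^ k * k ^ k / (Real.exp 1 * Real.sqrt k * (k / Real.exp 1) ^ k) := by gcongr
      _ = x ^ k / (Real.exp 1 * Real.sqrt k * (k / Real.exp 1) ^ k) := by
          rw [← mul_pow, div_mul_cancel₀ _ hk0.ne']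
      _ ≤ x ^ k / k.factorial := by gcongr
  calc Real.exp (2 * x - 2 - 1 / k) / x ≤ Real.exp (2 * x - 2 - 1 / k) / k := by gcongr
    _ = (Real.exp (x - 1 - 1 / (2 * k)) / Real.sqrt k) ^ 2 := by
        rw [div_pow, Real.sq_sqrt hk0.le, ← Real.exp_nat_mul]
        congr 2
        push_cast
        field_simp
    _ ≤ _ := by gcongr

theorem one_sub_inv_bounds {p : ℕ} (hp : 2 ≤ p) :
    1 / 2 ≤ 1 - 1 / (p : ℝ) ∧ 1 - 1 / (p : ℝ) < 1 := by
  have h2 : (2 : ℝ) ≤ p := by exact_mod_cast hp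
  have : 1 / (p : ℝ) ≤ 1 / 2 := by gcongr
  have : 0 < 1 / (p : ℝ) := by positivity
  constructor <;> linarith

theorem card_weightedBall_nonMultiple_ge {p : ℕ} (hp : 2 ≤ p) {m : ℕ} {x : ℝ} (hx : 1 ≤ x)
    (hxm : x ^ 2 = 2 * m * (1 - 1 / (p : ℝ))) :
    Real.exp (2 * x - 2 - 1 / ⌊x⌋₊) / x ≤ (weightedBall (nonMultiple p) ⌊x⌋₊ m).card := by
  refine (exp_le_mul_pow_div_factorial hx).trans ?_
  obtain ⟨k, hk⟩ : ∃ k, ⌊x⌋₊ = k + 1 :=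
    ⟨⌊x⌋₊ - 1, by have := (Nat.one_le_floor_iff x).mpr hx; omega⟩
  rw [hk]
  have h1 := card_weightedBall_ge (nonMultiple_pos p) (nonMultiple_zero p) k m
  have h2 := prod_nonMultiple_le hp (k + 1)
  have h3 := (one_sub_inv_bounds hp).1
  set c := 1 - 1 / (p : ℝ)
  rw [div_pow, div_le_iff₀ (by positivity), ← pow_mul, mul_comm (k + 1) 2, pow_mul, hxm, mul_pow]
  calc (2 * (m : ℝ)) ^ (k + 1) * c ^ (k + 1)
      ≤ (((k + 1).factorial * ∏ i ∈ Finset.range (k + 1), (nonMultiple p i : ℝ)) *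
      (weightedBall (nonMultiple p) (k + 1) m).card) * c ^ (k + 1) := by gcongr
    _ = (c ^ (k + 1) * ∏ i ∈ Finset.range (k + 1), (nonMultiple p i : ℝ)) *
        ((k + 1).factorial * (weightedBall (nonMultiple p) (k + 1) m).card) := by ring
    _ ≤ (k + 1).factorial * ((k + 1).factorial * (weightedBall (nonMultiple p) (k + 1) m).card) := by
        gcongr
    _ = _ := by ring

/-- With `c = 1 - 1/p`, one has `c * nonMultiple p i ≤ x ≤ c * m`; the second inequality amounts to
`c * m ≥ 2`. -/
theorem nonMultiple_le_of_lt_floor {p : ℕ} (hp : 2 ≤ p) {m : ℕ} (hm : 4 ≤ m) {x : ℝ} (hx : 1 ≤ x)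
    (hxm : x ^ 2 = 2 * m * (1 - 1 / (p : ℝ))) {i : ℕ} (hi : i < ⌊x⌋₊) :
    nonMultiple p i ≤ m := by
  have h1 := nonMultiple_le hp i
  have h2 : (i : ℝ) + 1 ≤ x := by
    have : ((i + 1 : ℕ) : ℝ) ≤ ⌊x⌋₊ := by exact_mod_cast hi
    push_cast at this
    exact this.trans (Nat.floor_le (by linarith))
  have h3 := (one_sub_inv_bounds hp).1
  set c := 1 - 1 / (p : ℝ)
  have hm' : (4 : ℝ) ≤ m := by exact_mod_cast hm
  have h4 : c * nonMultiple p i ≤ c * m := by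
    refine (h1.trans h2).trans ?_
    refine abs_le_of_sq_le_sq' ?_ (by positivity) |>.2
    rw [hxm]
    have : 2 * (m : ℝ) * c * 1 ≤ 2 * m * c * (c * m / 2) := by
      gcongr
      nlinarith
    nlinarith
  have := le_of_mul_le_mul_left h4 (by linarith)
  exact_mod_cast this

/-! ### Absorbing the polynomial factors. -/

/-- Split off one factor of the base `s`: the product `s * n` no longer involves `n`, and `n ≥ p ^
2` bounds the remaining power of `s`. What is left is an inequality in `p` alone. -/
theorem rpow_sqrt_mul_le {p : ℕ} (hp : 2 ≤ p) {n A : ℝ} (hn : (p : ℝ) ^ 2 ≤ n)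
    (hA0 : 0 ≤ A)
    (hA : A * (p * (p - 1)) ≤ 160 * (160 * (p : ℝ) / (p - 1)) ^ (Real.sqrt p - 1)) :
    ((p : ℝ) * (p - 1) / (160 * n)) ^ Real.sqrt p * (A * n) ≤ 1 := by
  have h2 : (2 : ℝ) ≤ p := by exact_mod_cast hp
  have hn0 : 0 < n := by nlinarith
  have hs : (0 : ℝ) < p * (p - 1) / (160 * n) := by
    have : (0 : ℝ) < p - 1 := by linarith
    positivity
  have hs0 : (p : ℝ) * (p - 1) / (160 * n) ≤ (160 * (p : ℝ) / (p - 1))⁻¹ := by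
    rw [inv_div, div_le_div_iff₀ (by positivity) (by positivity)]
    have : (p : ℝ) ^ 2 * (p - 1) ≤ n * (p - 1) := mul_le_mul_of_nonneg_right hn (by linarith)
    nlinarith
  have hsq : 1 ≤ Real.sqrt p := Real.one_le_sqrt.mpr (by linarith)
  set s := (p : ℝ) * (p - 1) / (160 * n) with hsdef
  set X := 160 * (p : ℝ) / (p - 1) with hX
  have hX0 : 0 < X := div_pos (by positivity) (by linarith)
  have h3 : s ^ Real.sqrt p = s * s ^ (Real.sqrt p - 1) := by
    rw [Real.rpow_sub_one hs.ne']; field_simp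
  have h4 : s ^ (Real.sqrt p - 1) ≤ (X ^ (Real.sqrt p - 1))⁻¹ := by
    rw [← Real.inv_rpow hX0.le]
    exact Real.rpow_le_rpow hs.le hs0 (by linarith)
  have h5 : s * n = p * (p - 1) / 160 := by rw [hsdef]; field_simp
  have hXp : 0 < X ^ (Real.sqrt p - 1) := Real.rpow_pos_of_pos hX0 _
  calc s ^ Real.sqrt p * (A * n) = (A * (s * n)) * s ^ (Real.sqrt p - 1) := by rw [h3]; ring
    _ ≤ (A * (s * n)) * (X ^ (Real.sqrt p - 1))⁻¹ := by gcongr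
    _ ≤ 1 := by
      rw [h5, ← div_eq_mul_inv, div_le_one hXp]
      linarith

theorem rpow_sqrt_mul_le_of_three_le {p : ℕ} (hp : 3 ≤ p) {n : ℝ} (hn : (p : ℝ) ^ 2 ≤ n) :
    ((p : ℝ) * (p - 1) / (160 * n)) ^ Real.sqrt p * (1400 * n) ≤ 1 := by
  refine rpow_sqrt_mul_le (by omega) hn (by norm_num) ?_
  rcases hp.eq_or_lt with rfl | hp4
  · have h1 : (8 / 11 : ℝ) ≤ Real.sqrt (3 : ℕ) - 1 := by
      have : (19 / 11 : ℝ) ≤ Real.sqrt (3 : ℕ) := Real.le_sqrt_of_sq_le (by norm_num)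
      linarith
    -- For `p = 3` the base is `160 * 3 / 2 = 240` and the target is `1400 * 6 / 160 = 52.5`.
    have h2 : (52.5 : ℝ) ≤ 240 ^ (8 / 11 : ℝ) := by
      rw [show (8 / 11 : ℝ) = (8 : ℕ) * ((11 : ℕ) : ℝ)⁻¹ by norm_num, Real.rpow_mul (by norm_num),
        Real.rpow_natCast]
      refine Real.le_rpow_inv_iff_of_pos (by norm_num) (by norm_num) (by norm_num) |>.mpr ?_
      rw [Real.rpow_natCast]
      norm_num
    have h3 := h2.trans (Real.rpow_le_rpow_of_exponent_le (by norm_num) h1)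
    norm_num at h3 ⊢
    linarith
  · have hp4' : (4 : ℝ) ≤ p := by exact_mod_cast hp4
    set u := Real.sqrt p with hu
    have hu2 : 2 ≤ u := Real.le_sqrt_of_sq_le (by linarith)
    have hup : u ^ 2 = p := Real.sq_sqrt (by linarith)
    have he := Real.exp_one_gt_d9
    have he' := Real.exp_one_lt_d9
    -- For `p ≥ 4` and `u = √p`, the chain is `X ^ (u - 1) ≥ e ^ (5(u - 1)) ≥ e ^ (2u + 1) ≥ 140 (u
    -- / 2) ^ 4`, where `X` is the base, and `160 * 140 / 16 = 1400`.
    have h1 : Real.exp 1 ^ 5 ≤ 160 * (p : ℝ) / (p - 1) := by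
      rw [le_div_iff₀ (by linarith)]
      have : Real.exp 1 ^ 5 ≤ 160 := by
        calc _ ≤ (2.7182818286 : ℝ) ^ 5 := by gcongr
          _ ≤ _ := by norm_num
      nlinarith
    have h2 : Real.exp (5 * (u - 1)) ≤ (160 * (p : ℝ) / (p - 1)) ^ (u - 1) := by
      rw [Real.exp_mul, show Real.exp 5 = Real.exp 1 ^ 5 by rw [← Real.exp_nat_mul]; norm_num]
      exact Real.rpow_le_rpow (by positivity) h1 (by linarith)
    have h3 : u / 2 ≤ Real.exp (u / 2 - 1) := by linarith [Real.add_one_le_exp (u / 2 - 1)]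
    have h4 : (u / 2) ^ 4 ≤ Real.exp (2 * u - 4) := by
      calc _ ≤ Real.exp (u / 2 - 1) ^ 4 := by gcongr
        _ = _ := by rw [← Real.exp_nat_mul]; congr 1; push_cast; ring
    have h5 : (140 : ℝ) * Real.exp (2 * u - 4) ≤ Real.exp (2 * u + 1) := by
      rw [show 2 * u + 1 = 5 + (2 * u - 4) by ring, Real.exp_add]
      gcongr
      rw [show Real.exp 5 = Real.exp 1 ^ 5 by rw [← Real.exp_nat_mul]; norm_num]
      calc (140 : ℝ) ≤ 2.7182818283 ^ 5 := by norm_num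
        _ ≤ _ := by gcongr
    have h6 : Real.exp (2 * u + 1) ≤ Real.exp (5 * (u - 1)) := Real.exp_le_exp.mpr (by linarith)
    have h7 : (p : ℝ) * (p - 1) ≤ u ^ 4 := by
      rw [show u ^ 4 = (u ^ 2) ^ 2 by ring, hup]; nlinarith
    nlinarith

theorem rpow_sqrt_mul_le_of_two_le {p : ℕ} (hp : 2 ≤ p) {n : ℝ} (hn : (p : ℝ) ^ 2 ≤ n) :
    ((p : ℝ) * (p - 1) / (160 * n)) ^ Real.sqrt p * (800 * n) ≤ 1 := by
  have hn0 : 0 ≤ n := (sq_nonneg _).trans hn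
  rcases hp.eq_or_lt with rfl | hp3
  · refine rpow_sqrt_mul_le le_rfl hn (by norm_num) ?_
    have h1 : (2 / 5 : ℝ) ≤ Real.sqrt (2 : ℕ) - 1 := by
      have : (7 / 5 : ℝ) ≤ Real.sqrt (2 : ℕ) := Real.le_sqrt_of_sq_le (by norm_num)
      linarith
    -- For `p = 2` the base is `320` and the target is `800 * 2 / 160 = 10`.
    have h2 : (10 : ℝ) ≤ 320 ^ (2 / 5 : ℝ) := by
      rw [show (2 / 5 : ℝ) = (2 : ℕ) * ((5 : ℕ) : ℝ)⁻¹ by norm_num, Real.rpow_mul (by norm_num),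
        Real.rpow_natCast]
      refine Real.le_rpow_inv_iff_of_pos (by norm_num) (by norm_num) (by norm_num) |>.mpr ?_
      rw [Real.rpow_natCast]
      norm_num
    have h3 := h2.trans (Real.rpow_le_rpow_of_exponent_le (by norm_num) h1)
    norm_num at h3 ⊢
    linarith
  · refine le_trans ?_ (rpow_sqrt_mul_le_of_three_le hp3 hn)
    have h0 : (0 : ℝ) ≤ p * (p - 1) / (160 * n) := by
      have : (3 : ℝ) ≤ p := by exact_mod_cast hp3
      have : (0 : ℝ) ≤ p - 1 := by linarith
      positivity
    have := Real.rpow_nonneg h0 (Real.sqrt p)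
    gcongr
    norm_num

/-- The slice grows like `exp (2x)`, while only `1.25√2 < 1.77` is claimed; the spare `exp (0.23 x)`
and the prefactor, at most `1 / (800 m)`, beat the losses `x` and `2m + 1`. The constant `1.25√2`
serves (a) with `m = r - 2` and, squared, (b) with `2m = r - 3`. -/
theorem exists_card_weightedSlice_gt {p : ℕ} (hp : 2 ≤ p) {m : ℕ} (hm : p ^ 2 ≤ m) :
    ∃ k s, (∀ i < k, nonMultiple p i ≤ m) ∧
      ((p : ℝ) * (p - 1) / (160 * m)) ^ Real.sqrt p *
        Real.exp (1.25 * Real.sqrt 2 * Real.sqrt ((1 - 1 / (p : ℝ)) * (2 * m))) <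
          (weightedSlice (nonMultiple p) k m s).card := by
  obtain ⟨hc, hc1⟩ := one_sub_inv_bounds hp
  have hm4 : 4 ≤ m := by nlinarith
  have hm4' : (4 : ℝ) ≤ m := by exact_mod_cast hm4
  set x := Real.sqrt ((1 - 1 / (p : ℝ)) * (2 * m)) with hx
  have hxm : x ^ 2 = 2 * m * (1 - 1 / (p : ℝ)) := by
    rw [hx, Real.sq_sqrt (by positivity)]; ring
  have hx2 : 2 ≤ x := Real.le_sqrt_of_sq_le (by nlinarith)
  obtain ⟨s, hs⟩ := exists_card_weightedSlice_ge (nonMultiple_pos p) ⌊x⌋₊ m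
  refine ⟨⌊x⌋₊, s, fun i hi => nonMultiple_le_of_lt_floor hp hm4 (by linarith) hxm hi,
    lt_of_lt_of_le ?_ hs⟩
  have hB := card_weightedBall_nonMultiple_ge hp (by linarith) hxm
  have hP := rpow_sqrt_mul_le_of_two_le hp (n := m) (by exact_mod_cast hm)
  set P := ((p : ℝ) * (p - 1) / (160 * m)) ^ Real.sqrt p
  refine lt_of_lt_of_le ?_ (div_le_div_of_nonneg_right hB (by positivity))
  rw [div_div, lt_div_iff₀ (by positivity)]
  have hfl : 1 / (⌊x⌋₊ : ℝ) ≤ 1 / 2 := by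
    have : (2 : ℝ) ≤ ⌊x⌋₊ := by exact_mod_cast Nat.le_floor (by exact_mod_cast hx2)
    gcongr
  have h2 : Real.sqrt 2 ≤ 1.416 := Real.sqrt_le_iff.mpr ⟨by norm_num, by norm_num⟩
  have he : Real.exp (1.77 * x) * Real.exp (0.23 * x) * Real.exp (-2.5) ≤
      Real.exp (2 * x - 2 - 1 / ⌊x⌋₊) := by
    rw [← Real.exp_add, ← Real.exp_add]
    exact Real.exp_le_exp.mpr (by linarith)
  have h3 : Real.exp (1.25 * Real.sqrt 2 * x) ≤ Real.exp (1.77 * x) :=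
    Real.exp_le_exp.mpr (by nlinarith)
  have h4 : 0.23 * x ≤ Real.exp (0.23 * x) := by linarith [Real.add_one_le_exp (0.23 * x)]
  have h5 : (1 / 20 : ℝ) ≤ Real.exp (-2.5) := by
    rw [Real.exp_neg, one_div]
    gcongr
    rw [show (2.5 : ℝ) = (5 : ℕ) * (1 / 2 : ℝ) by norm_num, Real.exp_nat_mul, ]
    have : Real.exp (1 / 2) ≤ 1.65 := by
      refine abs_le_of_sq_le_sq' ?_ (by norm_num) |>.2
      rw [← Real.exp_nat_mul]
      have := Real.exp_one_lt_d9
      norm_num at this ⊢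
      linarith
    calc _ ≤ (1.65 : ℝ) ^ 5 := by gcongr
      _ ≤ _ := by norm_num
  have hP' : P ≤ 1 / (800 * m) := by rw [le_div_iff₀ (by positivity)]; exact hP
  have hpos := Real.exp_pos (1.77 * x)
  calc P * Real.exp (1.25 * Real.sqrt 2 * x) * (x * (2 * m + 1))
      ≤ 1 / (800 * m) * Real.exp (1.77 * x) * (x * (2.25 * m)) := by gcongr; linarith
    _ = Real.exp (1.77 * x) * (2.25 / 800 * x) := by field_simp
    _ < Real.exp (1.77 * x) * (0.23 * x * (1 / 20)) := by
        refine mul_lt_mul_of_pos_left ?_ hpos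
        linarith
    _ ≤ Real.exp (1.77 * x) * (Real.exp (0.23 * x) * Real.exp (-2.5)) := by gcongr
    _ ≤ _ := by rw [← mul_assoc]; exact he

/-- The radii are those of (c), `2m + 1 = r - 2` and `m = (r - 3) / 2`. Only the slice loses a
factor linear in `m`, so a single prefactor suffices; the constant `1400` available for `p ≥ 3` is
used. -/
theorem exists_card_weightedSlice_mul_card_weightedBall_gt {p : ℕ} (hp : 3 ≤ p) {m : ℕ}
    (hm : p ^ 2 ≤ m) :
    ∃ k k' s, (∀ i < k, nonMultiple p i ≤ 2 * m + 1) ∧ (∀ i < k', nonMultiple p i ≤ m) ∧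
      ((p : ℝ) * (p - 1) / (160 * m)) ^ Real.sqrt p *
        Real.exp (2.5 * (1 + Real.sqrt 2 / 2) * Real.sqrt ((1 - 1 / (p : ℝ)) * (2 * m))) <
          (weightedSlice (nonMultiple p) k (2 * m + 1) s).card *
            (weightedBall (nonMultiple p) k' m).card := by
  have hp2 : 2 ≤ p := by omega
  have hc : 2 / 3 ≤ 1 - 1 / (p : ℝ) := by
    have h2 : (3 : ℝ) ≤ p := by exact_mod_cast hp
    have : 1 / (p : ℝ) ≤ 1 / 3 := by gcongr
    linarith
  have hm9 : 9 ≤ m := by nlinarith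
  have hm9' : (9 : ℝ) ≤ m := by exact_mod_cast hm9
  have hP := rpow_sqrt_mul_le_of_three_le hp (n := m) (by exact_mod_cast hm)
  set P := ((p : ℝ) * (p - 1) / (160 * m)) ^ Real.sqrt p
  have hP' : P ≤ 1 / (1400 * m) := by rw [le_div_iff₀ (by positivity)]; exact hP
  set c := 1 - 1 / (p : ℝ) with hcdef
  set x := Real.sqrt (c * (2 * m)) with hx
  have hxm : x ^ 2 = 2 * m * c := by
    rw [hx, Real.sq_sqrt (by positivity)]; ring
  have hx3 : 3 ≤ x := Real.le_sqrt_of_sq_le (by nlinarith)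
  set y := Real.sqrt (2 * (2 * m + 1 : ℕ) * c) with hy
  have hym : y ^ 2 = 2 * (2 * m + 1 : ℕ) * c := by
    rw [hy, Real.sq_sqrt (by positivity)]
  have hy5 : 5 ≤ y := Real.le_sqrt_of_sq_le (by push_cast; nlinarith)
  have hxy : Real.sqrt 2 * x ≤ y := by
    rw [hx, ← Real.sqrt_mul (by norm_num)]
    exact Real.sqrt_le_sqrt (by push_cast; nlinarith)
  have h2 : Real.sqrt 2 ≤ 1.415 := Real.sqrt_le_iff.mpr ⟨by norm_num, by norm_num⟩
  have h2' : 1.414 ≤ Real.sqrt 2 := Real.le_sqrt_of_sq_le (by norm_num)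
  obtain ⟨s, hs⟩ := exists_card_weightedSlice_ge (nonMultiple_pos p) ⌊y⌋₊ (2 * m + 1)
  refine ⟨⌊y⌋₊, ⌊x⌋₊, s,
    fun i hi => nonMultiple_le_of_lt_floor hp2 (by omega) (by linarith) hym hi,
    fun i hi => nonMultiple_le_of_lt_floor hp2 (by omega) (by linarith) hxm hi, ?_⟩
  have hB := card_weightedBall_nonMultiple_ge hp2 (by linarith) hxm
  have hB' := card_weightedBall_nonMultiple_ge hp2 (by linarith) hym
  have hfl : 1 / (⌊x⌋₊ : ℝ) ≤ 1 / 3 := by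
    have : (3 : ℝ) ≤ ⌊x⌋₊ := by exact_mod_cast Nat.le_floor (by exact_mod_cast hx3)
    gcongr
  have hfl' : 1 / (⌊y⌋₊ : ℝ) ≤ 1 / 5 := by
    have : (5 : ℝ) ≤ ⌊y⌋₊ := by exact_mod_cast Nat.le_floor (by exact_mod_cast hy5)
    gcongr
  -- `exp (2 t) / t` is increasing
  have hmono : Real.exp (2 * (Real.sqrt 2 * x)) * y ≤ Real.exp (2 * y) * (Real.sqrt 2 * x) := by
    have h0 : 1 ≤ 2 * (Real.sqrt 2 * x) := by nlinarith
    have h1 : 2 * (y - Real.sqrt 2 * x) + 1 ≤ Real.exp (2 * (y - Real.sqrt 2 * x)) :=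
      Real.add_one_le_exp _
    have h3 : Real.exp (2 * y) =
        Real.exp (2 * (Real.sqrt 2 * x)) * Real.exp (2 * (y - Real.sqrt 2 * x)) := by
      rw [← Real.exp_add]; congr 1; ring
    rw [h3, mul_assoc]
    gcongr
    have h4 := mul_le_mul_of_nonneg_right h1 (show 0 ≤ Real.sqrt 2 * x by positivity)
    have h5 := mul_nonneg (sub_nonneg.mpr hxy) (sub_nonneg.mpr h0)
    linarith
  have hS : Real.exp (2 * (Real.sqrt 2 * x) - 2.2) / (1.415 * x * (4.4 * m)) ≤
      (weightedSlice (nonMultiple p) ⌊y⌋₊ (2 * m + 1) s).card := by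
    refine le_trans ?_ hs
    refine le_trans ?_ (div_le_div_of_nonneg_right hB' (by positivity))
    rw [div_div]
    calc Real.exp (2 * (Real.sqrt 2 * x) - 2.2) / (1.415 * x * (4.4 * m))
        ≤ Real.exp (2 * (Real.sqrt 2 * x) - 2.2) / (Real.sqrt 2 * x * (2 * (2 * m + 1 : ℕ) + 1)) := by
          gcongr
          push_cast
          linarith
      _ ≤ Real.exp (2 * y - 2.2) / y / (2 * (2 * m + 1 : ℕ) + 1) := by
          rw [← div_div]
          refine div_le_div_of_nonneg_right ?_ (by positivity)
          rw [div_le_div_iff₀ (by positivity) (by positivity), Real.exp_sub, Real.exp_sub,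
            div_mul_eq_mul_div, div_mul_eq_mul_div]
          exact div_le_div_of_nonneg_right hmono (Real.exp_pos _).le
      _ ≤ _ := by
          rw [div_div]
          exact div_le_div_of_nonneg_right (Real.exp_le_exp.mpr (by linarith)) (by positivity)
  have hB2 : Real.exp (2 * x - 7 / 3) / x ≤ (weightedBall (nonMultiple p) ⌊x⌋₊ m).card := by
    refine le_trans ?_ hB
    exact div_le_div_of_nonneg_right (Real.exp_le_exp.mpr (by linarith)) (by positivity)
  refine lt_of_lt_of_le ?_ (mul_le_mul hS hB2 (by positivity) (by positivity))
  rw [div_mul_div_comm, lt_div_iff₀ (by positivity), ← Real.exp_add]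
  set E := Real.exp (2.5 * (1 + Real.sqrt 2 / 2) * x) with hE
  have hE0 : 0 < E := Real.exp_pos _
  -- Here `2√2 + 2` exceeds `2.5 (1 + √2/2)` by at least `0.56`, and `4.6 ≥ 2.2 + 7/3`.
  have hsplit : E * Real.exp (0.56 * x) * Real.exp (-4.6) ≤
      Real.exp (2 * (Real.sqrt 2 * x) - 2.2 + (2 * x - 7 / 3)) := by
    rw [hE, ← Real.exp_add, ← Real.exp_add]
    refine Real.exp_le_exp.mpr ?_
    nlinarith
  have h46 : (1 / 100 : ℝ) ≤ Real.exp (-4.6) := by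
    rw [Real.exp_neg, one_div]
    gcongr
    refine le_of_pow_le_pow_left₀ (n := 5) (by norm_num) (by norm_num) ?_
    rw [← Real.exp_nat_mul, show ((5 : ℕ) : ℝ) * 4.6 = (23 : ℕ) * 1 by norm_num, Real.exp_nat_mul]
    have := Real.exp_one_lt_d9
    calc _ ≤ (2.7182818286 : ℝ) ^ 23 := by gcongr
      _ ≤ _ := by norm_num
  have hquad : 0.57 * x ^ 2 ≤ Real.exp (0.56 * x) := by
    have h1 : 0.28 * x ≤ Real.exp (0.28 * x - 1) := by linarith [Real.add_one_le_exp (0.28 * x - 1)]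
    have h3 : 0.56 * x = (2 : ℕ) * (0.28 * x - 1) + (2 : ℕ) * 1 := by push_cast; ring
    rw [h3, Real.exp_add, Real.exp_nat_mul, Real.exp_nat_mul]
    have he := Real.exp_one_gt_d9
    calc 0.57 * x ^ 2 ≤ (0.28 * x) ^ 2 * 2.7182818283 ^ 2 := by nlinarith [sq_nonneg x]
      _ ≤ _ := by gcongr
  calc P * E * (1.415 * x * (4.4 * m) * x)
      ≤ 1 / (1400 * m) * E * (1.415 * x * (4.4 * m) * x) := by gcongr
    _ = E * (1.415 * 4.4 / 1400 * x ^ 2) := by field_simp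
    _ < E * (0.57 * x ^ 2 * (1 / 100)) := by
        refine mul_lt_mul_of_pos_left ?_ hE0
        have : 0 < x ^ 2 := by positivity
        linarith
    _ ≤ E * (Real.exp (0.56 * x) * Real.exp (-4.6)) := by gcongr
    _ ≤ _ := by rw [← mul_assoc]; exact hsplit

/-! ### Roots of `X ^ j + a` of maximal order. -/

/-- With `t` the order of `c` and `μ` a primitive `t * j`-th root of unity, `c = (μ ^ j) ^ i` for
some `i` prime to `t`. Units mod `t` lift to units mod `t * j`, so `i` may be replaced by an
exponent prime to `t * j`. -/
theorem exists_pow_eq_and_orderOf_eq {E : Type*} [Field E] [IsAlgClosed E] {c : E} {j : ℕ}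
    (hc : (orderOf c : E) ≠ 0) (hj : (j : E) ≠ 0) :
    ∃ x : E, x ^ j = c ∧ orderOf x = orderOf c * j := by
  set t := orderOf c with ht
  have ht0 : t ≠ 0 := fun h => hc (by simp [h])
  have hj0 : j ≠ 0 := fun h => hj (by simp [h])
  have : NeZero (t * j) := ⟨mul_ne_zero ht0 hj0⟩
  have : NeZero t := ⟨ht0⟩
  have : NeZero ((t * j : ℕ) : E) := ⟨by push_cast; exact mul_ne_zero hc hj⟩
  obtain ⟨μ, hμ⟩ := HasEnoughRootsOfUnity.exists_primitiveRoot E (t * j)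
  have hμj : IsPrimitiveRoot (μ ^ j) t := hμ.pow (Nat.pos_of_ne_zero (NeZero.ne _)) (mul_comm _ _)
  have hcp : IsPrimitiveRoot c t := IsPrimitiveRoot.orderOf c
  obtain ⟨i, -, hi⟩ := hμj.eq_pow_of_pow_eq_one hcp.pow_eq_one
  have hit : i.Coprime t := (hμj.pow_iff_coprime (Nat.pos_of_ne_zero ht0) i).mp (hi ▸ hcp)
  obtain ⟨y, hy⟩ := ZMod.unitsMap_surjective (Dvd.intro j rfl : t ∣ t * j) (ZMod.unitOfCoprime i hit)
  have hyc := ZMod.val_coe_unit_coprime y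
  have hymod : (y : ZMod (t * j)).val ≡ i [MOD t] := by
    rw [← ZMod.natCast_eq_natCast_iff]
    have := congrArg Units.val hy
    rw [ZMod.unitsMap_val, ZMod.coe_unitOfCoprime] at this
    rw [← this, ZMod.natCast_val]
  refine ⟨μ ^ (y : ZMod (t * j)).val, ?_, ?_⟩
  · rw [← pow_mul, mul_comm, pow_mul, ← hi]
    rwa [(hμj.isOfFinOrder ht0).pow_eq_pow_iff_modEq, ← hμj.eq_orderOf]
  · exact (hμ.pow_of_coprime _ hyc).eq_orderOf.symm

theorem natCast_orderOf_ne_zero {F : Type*} [Field F] [Finite F] {c : F} (hc : c ≠ 0) :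
    (orderOf c : F) ≠ 0 := by
  cases nonempty_fintype F
  have h : orderOf c ∣ Fintype.card F - 1 :=
    orderOf_dvd_of_pow_eq_one (FiniteField.pow_card_sub_one_eq_one c hc)
  obtain ⟨d, hd⟩ := h
  intro h0
  have h1 : ((Fintype.card F - 1 : ℕ) : F) = 0 := by rw [hd]; simp [h0]
  rw [Nat.cast_sub Fintype.card_pos, Nat.cast_card_eq_zero] at h1
  simp at h1

/-- Take `x ^ j = -a` with `x` of order `t * j`, `t` being the order of `-a`. A coincidence `x ^ i =
-a` with `i < j` gives `x ^ (j - i) = 1`, impossible; `x ^ i = -a⁻¹` gives `x ^ (i + j) = 1`,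
forcing `t ≤ 2` and hence `a = a⁻¹`. -/
theorem exists_separating_root {F : Type*} [Field F] [Finite F] {a : F} (ha : a ≠ 0) {j : ℕ}
    (hj : (j : F) ≠ 0) :
    ∃ x : AlgebraicClosure F, x ^ j + algebraMap F _ a = 0 ∧ ∀ i, 0 < i → i ≤ j →
      (x ^ i + algebraMap F _ a = 0 → i = j) ∧ (a ≠ a⁻¹ → x ^ i + algebraMap F _ a⁻¹ ≠ 0) := by
  set f := algebraMap F (AlgebraicClosure F) with hf
  have ho : orderOf (f (-a)) = orderOf (-a) := orderOf_injective f.toMonoidHom f.injective _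
  have ht : (orderOf (f (-a)) : AlgebraicClosure F) ≠ 0 := by
    rw [ho, ← map_natCast f]
    exact (map_ne_zero f).mpr (natCast_orderOf_ne_zero (neg_ne_zero.mpr ha))
  have hj' : (j : AlgebraicClosure F) ≠ 0 := by
    rw [← map_natCast f]; exact (map_ne_zero f).mpr hj
  obtain ⟨x, hx, hxo⟩ := exists_pow_eq_and_orderOf_eq ht hj'
  have hx0 : x ≠ 0 := by
    rintro rfl
    have : j ≠ 0 := fun h => hj (by simp [h])
    rw [zero_pow this, eq_comm, map_eq_zero, neg_eq_zero] at hx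
    exact ha hx
  set t := orderOf (f (-a)) with htd
  have ht0 : 0 < t := Nat.pos_of_ne_zero fun h => ht (by simp [h])
  refine ⟨x, by rw [hx]; simp, fun i hi hij => ⟨fun h => ?_, fun hne h => ?_⟩⟩
  · have h1 : x ^ i = x ^ j := by rw [hx, map_neg]; exact eq_neg_of_add_eq_zero_left h
    have h2 : x ^ (j - i) = 1 := by
      have := pow_sub₀ x hx0 hij
      rw [this, h1, mul_inv_cancel₀ (pow_ne_zero _ hx0)]
    have h3 := orderOf_dvd_of_pow_eq_one h2
    rw [hxo] at h3
    by_contra hne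
    have := Nat.le_of_dvd (by omega) h3
    have := Nat.le_mul_of_pos_left j ht0
    omega
  · have h1 : x ^ i = f (-a⁻¹) := by rw [map_neg]; exact eq_neg_of_add_eq_zero_left h
    have h2 : x ^ (i + j) = 1 := by
      rw [pow_add, h1, hx, ← map_mul]; simp [ha]
    have h3 := orderOf_dvd_of_pow_eq_one h2
    rw [hxo] at h3
    have h4 := Nat.le_of_dvd (by omega) h3
    have h5 : t ≤ 2 := by
      by_contra h
      have : 3 * j ≤ t * j := Nat.mul_le_mul_right _ (by omega)
      omega
    have h6 : (-a) ^ 2 = 1 := by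
      refine orderOf_dvd_iff_pow_eq_one.mp ?_
      rw [← ho]
      interval_cases t <;> decide
    apply hne
    rw [neg_sq] at h6
    field_simp
    exact h6

/-! ### Multiplicative independence of the binomials. -/

section Independence

open Polynomial

variable {F : Type*} [Field F] {a : F} {k : ℕ} {n : Fin k → ℕ}

/-- Were `u i₀` positive, the left side would vanish at the separating root for `n i₀`. On the right
only the factor `X ^ n i₀ + C a` could vanish there, and its exponent is then zero. -/
theorem exponent_nonpos_of_max [Finite F] (ha : a ≠ 0) (hinj : Function.Injective n) (hpos : ∀ i, 0 < n i)
    (hn : ∀ i, (n i : F) ≠ 0) {u v : Fin k → ℤ} (hv : a = a⁻¹ → v = 0) {c : F}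
    (h : C c * ∏ i, ((X ^ n i + C a) ^ (u i).toNat * (X ^ n i + C a⁻¹) ^ (v i).toNat) =
      ∏ i, ((X ^ n i + C a) ^ (-u i).toNat * (X ^ n i + C a⁻¹) ^ (-v i).toNat))
    {i₀ : Fin k} (hmax : ∀ i, u i ≠ 0 ∨ v i ≠ 0 → n i ≤ n i₀) : u i₀ ≤ 0 := by
  by_contra! hu
  obtain ⟨x, hx, hx'⟩ := exists_separating_root ha (hn i₀)
  have h1 := congrArg (aeval x) h
  simp only [map_mul, map_prod, map_pow, map_add, aeval_X, aeval_C] at h1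
  have h2 : ∏ i, ((x ^ n i + algebraMap F (AlgebraicClosure F) a) ^ (u i).toNat *
      (x ^ n i + algebraMap F (AlgebraicClosure F) a⁻¹) ^ (v i).toNat) = 0 := by
    refine Finset.prod_eq_zero (Finset.mem_univ i₀) ?_
    rw [hx, zero_pow (by omega), zero_mul]
  rw [h2, mul_zero, eq_comm, Finset.prod_eq_zero_iff] at h1
  obtain ⟨i, -, hi⟩ := h1
  rcases mul_eq_zero.mp hi with hi | hi
  · obtain ⟨hi1, hi2⟩ := pow_eq_zero_iff'.mp hi
    have hui : u i ≠ 0 := by rintro h; simp [h] at hi2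
    have := hinj ((hx' _ (hpos i) (hmax i (Or.inl hui))).1 hi1)
    subst this
    omega
  · obtain ⟨hi1, hi2⟩ := pow_eq_zero_iff'.mp hi
    have hvi : v i ≠ 0 := by rintro h; simp [h] at hi2
    refine (hx' _ (hpos i) (hmax i (Or.inr hvi))).2 (fun h => hvi ?_) hi1
    rw [hv h]; rfl

/-- Look at the largest `n i` with a non-zero exponent. Negating the exponents gives the opposite
inequality, and exchanging `a` with `a⁻¹` exchanges `u` with `v`. The condition `hv` covers `a =
a⁻¹`, where the two families of binomials coincide. -/
theorem exponents_eq_zero [Finite F] (ha : a ≠ 0) (hinj : Function.Injective n) (hpos : ∀ i, 0 < n i)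
    (hn : ∀ i, (n i : F) ≠ 0) {u v : Fin k → ℤ} (hv : a = a⁻¹ → v = 0) {c : F} (hc : c ≠ 0)
    (h : C c * ∏ i, ((X ^ n i + C a) ^ (u i).toNat * (X ^ n i + C a⁻¹) ^ (v i).toNat) =
      ∏ i, ((X ^ n i + C a) ^ (-u i).toNat * (X ^ n i + C a⁻¹) ^ (-v i).toNat)) :
    u = 0 ∧ v = 0 := by
  have h' : C c⁻¹ * ∏ i, ((X ^ n i + C a) ^ (-u i).toNat * (X ^ n i + C a⁻¹) ^ (-v i).toNat) =
      ∏ i, ((X ^ n i + C a) ^ (- -u i).toNat * (X ^ n i + C a⁻¹) ^ (- -v i).toNat) := by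
    rw [← h, ← mul_assoc, ← C_mul, inv_mul_cancel₀ hc]
    simp
  by_contra hne
  have hex : (Finset.univ.filter fun i => u i ≠ 0 ∨ v i ≠ 0).Nonempty := by
    by_contra hempty
    rw [Finset.not_nonempty_iff_eq_empty, Finset.filter_eq_empty_iff] at hempty
    push Not at hempty
    exact hne ⟨funext fun i => (hempty (Finset.mem_univ i)).1,
      funext fun i => (hempty (Finset.mem_univ i)).2⟩
  obtain ⟨i₀, hi₀, hmax⟩ := Finset.exists_max_image _ n hex
  simp only [Finset.mem_filter, Finset.mem_univ, true_and] at hi₀ hmax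
  have hu : u i₀ = 0 := by
    have h1 := exponent_nonpos_of_max ha hinj hpos hn hv h hmax
    have h2 := exponent_nonpos_of_max ha hinj hpos hn (u := fun i => -u i) (v := fun i => -v i)
      (fun e => by simp [hv e]; rfl) h' (by simpa using hmax)
    omega
  have hvi : v i₀ ≠ 0 := by tauto
  have hane : a ≠ a⁻¹ := fun e => hvi (by simp [hv e])
  have hmax' : ∀ i, v i ≠ 0 ∨ u i ≠ 0 → n i ≤ n i₀ := fun i hi => hmax i hi.symm
  have h1 := exponent_nonpos_of_max (inv_ne_zero ha) hinj hpos hn (u := v) (v := u)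
    (fun e => absurd (by simpa using e.symm) hane) (c := c)
    (by simpa only [inv_inv, mul_comm] using h) hmax'
  have h2 := exponent_nonpos_of_max (inv_ne_zero ha) hinj hpos hn (u := fun i => -v i)
    (v := fun i => -u i) (fun e => absurd (by simpa using e.symm) hane) (c := c⁻¹)
    (by simpa only [inv_inv, mul_comm] using h') (by simpa using hmax')
  omega

variable {K : Type*} [Field K] [Algebra F K] {ζ : K} {N : ℕ}

theorem pow_add_algebraMap_ne_zero (hζ : ∀ P : F[X], P.natDegree ≤ N → aeval ζ P = 0 → P = 0)
    {j : ℕ} (hj0 : 0 < j) (hj : j ≤ N) (b : F) : ζ ^ j + algebraMap F K b ≠ 0 := by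
  intro h
  have hd : (X ^ j + C b : F[X]).natDegree = j := natDegree_X_pow_add_C
  have := hζ (X ^ j + C b) (by rw [hd]; exact hj) (by simpa using h)
  rw [this, natDegree_zero] at hd
  omega

theorem zpow_eq_pow_div_pow {z : K} (hz : z ≠ 0) (u : ℤ) :
    z ^ u = z ^ u.toNat / z ^ (-u).toNat := by
  rw [← zpow_natCast, ← zpow_natCast, ← zpow_sub₀ hz, Int.toNat_sub_toNat_neg]

theorem natDegree_prod_X_pow_add_C_le (u v : Fin k → ℕ) (b : F) :
    (∏ i, ((X ^ n i + C a) ^ u i * (X ^ n i + C b) ^ v i)).natDegree ≤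
      ∑ i, n i * (u i + v i) := by
  refine (natDegree_prod_le _ _).trans (Finset.sum_le_sum fun i _ => ?_)
  refine natDegree_mul_le.trans ?_
  have h (b : F) (e : ℕ) : ((X ^ n i + C b) ^ e).natDegree ≤ e * n i := by
    refine natDegree_pow_le.trans ?_
    rw [natDegree_X_pow_add_C]
  calc _ ≤ u i * n i + v i * n i := add_le_add (h a _) (h b _)
    _ = _ := by ring

/-- Moving negative exponents to the other side gives two polynomials of degree at most `N` agreeing
at `ζ`, hence equal. -/
theorem exponents_eq_zero_of_prod_zpow_eq_one [Finite F]
    (hζ : ∀ P : F[X], P.natDegree ≤ N → aeval ζ P = 0 → P = 0)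
    (ha : a ≠ 0) (hinj : Function.Injective n) (hpos : ∀ i, 0 < n i) (hnN : ∀ i, n i ≤ N)
    (hn : ∀ i, (n i : F) ≠ 0) {u v : Fin k → ℤ} (hv : a = a⁻¹ → v = 0) {c : F} (hc : c ≠ 0)
    (hdeg : ∑ i, n i * ((u i).toNat + (v i).toNat) ≤ N)
    (hdeg' : ∑ i, n i * ((-u i).toNat + (-v i).toNat) ≤ N)
    (h : algebraMap F K c * ∏ i, ((ζ ^ n i + algebraMap F K a) ^ u i *
      (ζ ^ n i + algebraMap F K a⁻¹) ^ v i) = 1) : u = 0 ∧ v = 0 := by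
  have hne (b : F) (i : Fin k) := pow_add_algebraMap_ne_zero hζ (hpos i) (hnN i) b
  refine exponents_eq_zero ha hinj hpos hn hv hc (sub_eq_zero.mp (hζ _ ?_ ?_))
  · refine (natDegree_sub_le _ _).trans (max_le ?_ ?_)
    · exact (natDegree_C_mul_le _ _).trans ((natDegree_prod_X_pow_add_C_le _ _ _).trans hdeg)
    · exact (natDegree_prod_X_pow_add_C_le _ _ _).trans hdeg'
  · simp only [map_sub, map_mul, map_prod, map_pow, map_add, aeval_X, aeval_C, sub_eq_zero]
    have e : ∀ i, (ζ ^ n i + algebraMap F K a) ^ u i * (ζ ^ n i + algebraMap F K a⁻¹) ^ v i =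
        ((ζ ^ n i + algebraMap F K a) ^ (u i).toNat *
          (ζ ^ n i + algebraMap F K a⁻¹) ^ (v i).toNat) /
        ((ζ ^ n i + algebraMap F K a) ^ (-u i).toNat *
          (ζ ^ n i + algebraMap F K a⁻¹) ^ (-v i).toNat) := fun i => by
      rw [zpow_eq_pow_div_pow (hne a i), zpow_eq_pow_div_pow (hne a⁻¹ i), div_mul_div_comm]
    rw [Finset.prod_congr rfl fun i _ => e i, Finset.prod_div_distrib, mul_div_assoc',
      div_eq_one_iff_eq] at h
    · exact h
    · exact Finset.prod_ne_zero_iff.mpr fun i _ =>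
        mul_ne_zero (pow_ne_zero _ (hne a i)) (pow_ne_zero _ (hne _ i))

end Independence

/-! ### From exponent vectors to orders. -/

theorem card_le_orderOf {K ι : Type*} [Field K] [Finite K] {γ : K} (hγ : γ ≠ 0) (T : Finset ι)
    (φ : ι → K) (hφ : ∀ t ∈ T, ∃ n : ℤ, γ ^ n = φ t) (hinj : Set.InjOn φ T) :
    T.card ≤ orderOf γ := by
  classical
  have hpos : 0 < orderOf γ := by
    rw [← Units.val_mk0 hγ, orderOf_units]; exact orderOf_pos _
  rw [← Finset.card_range (orderOf γ), ← Finset.card_image_of_injOn hinj]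
  refine (Finset.card_le_card fun y hy => ?_).trans
    (Finset.card_image_le (s := Finset.range (orderOf γ)) (f := fun i => γ ^ i))
  obtain ⟨t, ht, rfl⟩ := Finset.mem_image.mp hy
  obtain ⟨n, hn⟩ := hφ t ht
  have h0 : (0 : ℤ) < orderOf γ := by exact_mod_cast hpos
  refine Finset.mem_image.mpr ⟨(n % orderOf γ).toNat, Finset.mem_range.mpr ?_, ?_⟩
  · have := Int.emod_lt_of_pos n h0
    have := Int.emod_nonneg n h0.ne'
    omega
  · rw [← hn, ← zpow_natCast, Int.toNat_of_nonneg (Int.emod_nonneg n h0.ne')]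
    nth_rewrite 2 [← Int.emod_add_mul_ediv n (orderOf γ)]
    rw [zpow_add₀ hγ, zpow_mul, zpow_natCast, pow_orderOf_eq_one, one_zpow, mul_one]

theorem sum_mul_toNat_sub_le_of_mem_weightedBall {a : ℕ → ℕ} (ha : ∀ i, 0 < a i) {k m : ℕ}
    {W W' : Fin k → ℤ} (hW : W ∈ weightedBall a k m) (hW' : W' ∈ weightedBall a k m) :
    ∑ i : Fin k, a i * ((W i - W' i).toNat + (-(W i - W' i)).toNat) ≤ 2 * m := by
  rw [mem_weightedBall ha] at hW hW'
  zify
  calc ∑ i : Fin k, (a i : ℤ) * (((W i - W' i).toNat : ℤ) + ((-(W i - W' i)).toNat : ℤ))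
      ≤ ∑ i : Fin k, ((a i : ℤ) * |W i| + (a i : ℤ) * |W' i|) := by
        refine Finset.sum_le_sum fun i _ => ?_
        rw [← mul_add]
        refine mul_le_mul_of_nonneg_left ?_ (by positivity)
        refine le_trans (le_of_eq ?_) (abs_sub (W i) (W' i))
        rcases abs_cases (W i - W' i) with h | h <;> omega
    _ ≤ 2 * m := by rw [Finset.sum_add_distrib]; linarith

/-- Equal weighted sums make the positive and negative parts of `W - W'` have equal weight, and
together they weigh at most `2 * m`. This halving is what the slice is for. -/
theorem sum_mul_toNat_sub_le_of_mem_weightedSlice {a : ℕ → ℕ} (ha : ∀ i, 0 < a i) {k m : ℕ}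
    {s : ℤ} {W W' : Fin k → ℤ} (hW : W ∈ weightedSlice a k m s)
    (hW' : W' ∈ weightedSlice a k m s) :
    ∑ i : Fin k, a i * (W i - W' i).toNat ≤ m ∧ ∑ i : Fin k, a i * (-(W i - W' i)).toNat ≤ m := by
  rw [weightedSlice, Finset.mem_filter] at hW hW'
  have h1 := sum_mul_toNat_sub_le_of_mem_weightedBall ha hW.1 hW'.1
  simp only [mul_add, Finset.sum_add_distrib] at h1
  have h2 : ∑ i : Fin k, a i * (W i - W' i).toNat = ∑ i : Fin k, a i * (-(W i - W' i)).toNat := by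
    zify
    rw [← sub_eq_zero, ← Finset.sum_sub_distrib, ← sub_eq_zero.mpr (hW.2.trans hW'.2.symm),
      ← Finset.sum_sub_distrib]
    refine Finset.sum_congr rfl fun i _ => ?_
    rw [← mul_sub, ← mul_sub]
    congr 1
    omega
  omega

section Powers

variable {K : Type*} [Field K] {k : ℕ}

theorem prod_zpow_eq_zpow_sum {ζ : K} (hζ : ζ ≠ 0) (e : Fin k → ℤ) :
    ∏ i, ζ ^ e i = ζ ^ ∑ i, e i := by
  induction k with
  | zero => simp
  | succ k ih => rw [Fin.prod_univ_succ, Fin.sum_univ_succ, zpow_add₀ hζ, ih]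

theorem exists_zpow_eq_prod_zpow {γ : K} (hγ : γ ≠ 0) {y : Fin k → K}
    (hy : ∀ i, ∃ M : ℤ, γ ^ M = y i) (W : Fin k → ℤ) : ∃ M : ℤ, γ ^ M = ∏ i, y i ^ W i := by
  choose M hM using hy
  refine ⟨∑ i, M i * W i, ?_⟩
  rw [← prod_zpow_eq_zpow_sum hγ]
  refine Finset.prod_congr rfl fun i _ => ?_
  rw [zpow_mul, hM]

end Powers

/-- Every `ζ ^ j` with `j` prime to `r` is the image of `ζ` under a ring endomorphism that fixes
`F` and is a power map. -/
def HasPowerConjugates (F : Type*) {K : Type*} [Field F] [Field K] [Algebra F K] (ζ : K) (r : ℕ) :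
    Prop :=
  ∀ j : ℕ, ¬ r ∣ j → ∃ (σ : K →+* K) (M : ℕ), (∀ x, σ x = x ^ M) ∧
    (∀ b : F, σ (algebraMap F K b) = algebraMap F K b) ∧ σ ζ = ζ ^ j

section Orders

open Polynomial

variable {F K : Type*} [Field F] [Field K] [Algebra F K] {ζ : K} {r : ℕ}

theorem HasPowerConjugates.exists_zpow (h : HasPowerConjugates F ζ r) {j : ℕ} (hj : ¬ r ∣ j)
    (E : ℤ) (a : F) :
    ∃ M : ℤ, (ζ ^ E * (ζ + algebraMap F K a)) ^ M =
      ζ ^ (E * j) * (ζ ^ j + algebraMap F K a) := by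
  obtain ⟨σ, M, h1, h2, h3⟩ := h j hj
  refine ⟨M, ?_⟩
  rw [zpow_natCast, ← h1, map_mul, map_zpow₀, map_add, h2, h3, mul_comm E, zpow_mul, zpow_natCast]

/-- The conjugate at `r - j` involves `ζ ^ (-j) + a = a * ζ ^ (-j) * (ζ ^ j + a⁻¹)`. -/
theorem HasPowerConjugates.exists_zpow_neg (h : HasPowerConjugates F ζ r) (hζr : ζ ^ r = 1)
    (hζ0 : ζ ≠ 0) {j : ℕ} (hj0 : 0 < j) (hj : j < r) (E : ℤ) {a : F} (ha : a ≠ 0) :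
    ∃ M : ℤ, (ζ ^ E * (ζ + algebraMap F K a)) ^ M =
      ζ ^ (-(E + 1) * j) * algebraMap F K a * (ζ ^ j + algebraMap F K a⁻¹) := by
  have hjr : ¬ r ∣ r - j := Nat.not_dvd_of_pos_of_lt (by omega) (by omega)
  obtain ⟨M, hM⟩ := h.exists_zpow hjr E a
  refine ⟨M, ?_⟩
  have h1 : ζ ^ ((r - j : ℕ)) = ζ ^ (-(j : ℤ)) := by
    rw [pow_sub₀ _ hζ0 hj.le, hζr, one_mul, zpow_neg, zpow_natCast]
  have ha' : algebraMap F K a ≠ 0 := (_root_.map_ne_zero _).mpr ha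
  rw [hM, mul_comm E, zpow_mul, zpow_natCast, h1, ← zpow_mul, map_inv₀,
    show -(E + 1) * (j : ℤ) = -(j : ℤ) * E + -(j : ℤ) by ring, zpow_add₀ hζ0, zpow_neg ζ (j : ℤ),
    zpow_natCast]
  field_simp
  ring

variable {a : F} {n : ℕ → ℕ} {k : ℕ}

theorem card_weightedSlice_le_orderOf [Finite F] [Finite K] (hr : 2 ≤ r)
    (hζ : ∀ P : F[X], P.natDegree ≤ r - 2 → aeval ζ P = 0 → P = 0) (hζ0 : ζ ≠ 0)
    (hconj : HasPowerConjugates F ζ r) (ha : a ≠ 0) (hγ : ζ + algebraMap F K a ≠ 0)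
    (hmono : StrictMono n) (hpos : ∀ i, 0 < n i) (hn : ∀ i, (n i : F) ≠ 0)
    (hk : ∀ i < k, n i ≤ r - 2) (s E : ℤ) :
    (weightedSlice n k (r - 2) s).card ≤ orderOf (ζ ^ E * (ζ + algebraMap F K a)) := by
  have hγ0 : ζ ^ E * (ζ + algebraMap F K a) ≠ 0 := mul_ne_zero (zpow_ne_zero _ hζ0) hγ
  have hk' : ∀ i : Fin k, n i ≤ r - 2 := fun i => hk i i.2
  have hne (i : Fin k) := pow_add_algebraMap_ne_zero hζ (hpos i) (hk' i) a
  refine card_le_orderOf hγ0 _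
    (fun W => ∏ i : Fin k, (ζ ^ (E * n i) * (ζ ^ n i + algebraMap F K a)) ^ W i)
    (fun W _ => exists_zpow_eq_prod_zpow hγ0 (fun i => hconj.exists_zpow
      (Nat.not_dvd_of_pos_of_lt (hpos i) (by have := hk' i; omega)) E a) W) ?_
  -- On a slice the power of `ζ` is the constant `ζ ^ (E * s)` and cancels.
  have hφ : ∀ W ∈ weightedSlice n k (r - 2) s,
      ∏ i : Fin k, (ζ ^ (E * n i) * (ζ ^ n i + algebraMap F K a)) ^ W i =
        ζ ^ (E * s) * ∏ i : Fin k, (ζ ^ n i + algebraMap F K a) ^ W i := by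
    intro W hW
    rw [weightedSlice, Finset.mem_filter] at hW
    simp only [mul_zpow, Finset.prod_mul_distrib, ← zpow_mul]
    rw [prod_zpow_eq_zpow_sum hζ0, ← hW.2, Finset.mul_sum]
    simp only [mul_assoc]
  intro W hW W' hW' h
  rw [Finset.mem_coe] at hW hW'
  simp only at h
  rw [hφ W hW, hφ W' hW', mul_right_inj' (zpow_ne_zero _ hζ0)] at h
  obtain ⟨hd, hd'⟩ := sum_mul_toNat_sub_le_of_mem_weightedSlice hpos hW hW'
  have key := exponents_eq_zero_of_prod_zpow_eq_one (n := fun i : Fin k => n i)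
    (u := fun i => W i - W' i) (v := 0) hζ ha
    (fun i j hij => Fin.ext (hmono.injective hij)) (fun i => hpos i) hk' (fun i => hn i)
    (fun _ => rfl) one_ne_zero (by simpa using hd) (by simpa using hd') (by
      simp only [map_one, one_mul, Pi.zero_apply, zpow_zero, mul_one, zpow_sub₀ (hne _),
        Finset.prod_div_distrib]
      rw [h, div_self]
      exact Finset.prod_ne_zero_iff.mpr fun i _ => zpow_ne_zero _ (hne i))
  exact funext fun i => sub_eq_zero.mp (congrFun key.1 i)

/-- Both families of binomials are used, each contributing degree at most `m` per side, so `2 * m ≤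
r - 2` is the budget. The powers of `ζ` combine to `ζ ^ (-s)`; the powers of `a` vary with the
vector and go into the constant `c`. -/
theorem card_weightedSlice_sq_le_orderOf [Finite F] [Finite K] {m : ℕ} (hr : 2 * m + 2 ≤ r)
    (hζ : ∀ P : F[X], P.natDegree ≤ r - 2 → aeval ζ P = 0 → P = 0) (hζ0 : ζ ≠ 0)
    (hζr : ζ ^ r = 1) (hconj : HasPowerConjugates F ζ r) (ha : a ≠ 0) (ha' : a ≠ a⁻¹)
    (hγ : ζ + algebraMap F K a ≠ 0)
    (hmono : StrictMono n) (hpos : ∀ i, 0 < n i) (hn : ∀ i, (n i : F) ≠ 0)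
    (hk : ∀ i < k, n i ≤ m) (s E : ℤ) :
    (weightedSlice n k m s).card ^ 2 ≤ orderOf (ζ ^ E * (ζ + algebraMap F K a)) := by
  have hγ0 : ζ ^ E * (ζ + algebraMap F K a) ≠ 0 := mul_ne_zero (zpow_ne_zero _ hζ0) hγ
  have hk' : ∀ i : Fin k, n i ≤ r - 2 := fun i => (hk i i.2).trans (by omega)
  have hne (b : F) (i : Fin k) := pow_add_algebraMap_ne_zero hζ (hpos i) (hk' i) b
  have ha0 : algebraMap F K a ≠ 0 := (_root_.map_ne_zero _).mpr ha
  rw [sq, ← Finset.card_product]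
  refine card_le_orderOf hγ0 _
    (fun W => (∏ i : Fin k, (ζ ^ (E * n i) * (ζ ^ n i + algebraMap F K a)) ^ W.1 i) *
      ∏ i : Fin k, (ζ ^ (-(E + 1) * n i) * algebraMap F K a *
        (ζ ^ n i + algebraMap F K a⁻¹)) ^ W.2 i) (fun W _ => ?_) ?_
  · have hj : ∀ i : Fin k, n i < r := fun i => by have := hk' i; omega
    obtain ⟨M, hM⟩ := exists_zpow_eq_prod_zpow hγ0 (fun i : Fin k => hconj.exists_zpow
      (Nat.not_dvd_of_pos_of_lt (hpos i) (hj i)) E a) W.1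
    obtain ⟨M', hM'⟩ := exists_zpow_eq_prod_zpow hγ0 (fun i : Fin k => hconj.exists_zpow_neg
      hζr hζ0 (hpos i) (hj i) E ha) W.2
    exact ⟨M + M', by rw [zpow_add₀ hγ0, hM, hM']⟩
  have hφ : ∀ W ∈ weightedSlice n k m s, ∀ V ∈ weightedSlice n k m s,
      (∏ i : Fin k, (ζ ^ (E * n i) * (ζ ^ n i + algebraMap F K a)) ^ W i) *
      ∏ i : Fin k, (ζ ^ (-(E + 1) * n i) * algebraMap F K a *
        (ζ ^ n i + algebraMap F K a⁻¹)) ^ V i =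
        ζ ^ (-s) * (algebraMap F K a ^ (∑ i, V i) * ∏ i : Fin k,
          ((ζ ^ n i + algebraMap F K a) ^ W i * (ζ ^ n i + algebraMap F K a⁻¹) ^ V i)) := by
    intro W hW V hV
    rw [weightedSlice, Finset.mem_filter] at hW hV
    simp only [mul_zpow, Finset.prod_mul_distrib, ← zpow_mul]
    rw [prod_zpow_eq_zpow_sum hζ0, prod_zpow_eq_zpow_sum hζ0, prod_zpow_eq_zpow_sum ha0]
    have e1 : ∑ i : Fin k, E * (n i : ℤ) * W i = E * s := by
      rw [← hW.2, Finset.mul_sum]; simp only [mul_assoc]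
    have e2 : ∑ i : Fin k, -(E + 1) * (n i : ℤ) * V i = -(E + 1) * s := by
      rw [← hV.2, Finset.mul_sum]; simp only [mul_assoc]
    rw [e1, e2, show -s = E * s + -(E + 1) * s by ring, zpow_add₀ hζ0]
    ring
  rintro ⟨W, V⟩ hWV ⟨W', V'⟩ hWV' h
  rw [Finset.mem_coe, Finset.mem_product] at hWV hWV'
  obtain ⟨hW, hV⟩ := hWV
  obtain ⟨hW', hV'⟩ := hWV'
  simp only at h hW hV hW' hV'
  rw [hφ W hW V hV, hφ W' hW' V' hV', mul_right_inj' (zpow_ne_zero _ hζ0)] at h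
  obtain ⟨hd1, hd1'⟩ := sum_mul_toNat_sub_le_of_mem_weightedSlice hpos hW hW'
  obtain ⟨hd2, hd2'⟩ := sum_mul_toNat_sub_le_of_mem_weightedSlice hpos hV hV'
  have key := exponents_eq_zero_of_prod_zpow_eq_one (n := fun i : Fin k => n i)
    (u := fun i => W i - W' i) (v := fun i => V i - V' i) (c := a ^ (∑ i, V i - ∑ i, V' i)) hζ ha
    (fun i j hij => Fin.ext (hmono.injective hij)) (fun i => hpos i) hk' (fun i => hn i)
    (fun h => absurd h ha') (zpow_ne_zero _ ha)
    (by simp only [mul_add, Finset.sum_add_distrib]; omega)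
    (by simp only [mul_add, Finset.sum_add_distrib]; omega) (by
      have e : ∀ i : Fin k, (ζ ^ n i + algebraMap F K a) ^ (W i - W' i) *
          (ζ ^ n i + algebraMap F K a⁻¹) ^ (V i - V' i) =
          ((ζ ^ n i + algebraMap F K a) ^ W i * (ζ ^ n i + algebraMap F K a⁻¹) ^ V i) /
          ((ζ ^ n i + algebraMap F K a) ^ W' i * (ζ ^ n i + algebraMap F K a⁻¹) ^ V' i) :=
        fun i => by rw [zpow_sub₀ (hne a i), zpow_sub₀ (hne a⁻¹ i), div_mul_div_comm]
      rw [Finset.prod_congr rfl fun i _ => e i, Finset.prod_div_distrib, map_zpow₀,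
        zpow_sub₀ ha0, div_mul_div_comm, h, div_self]
      exact mul_ne_zero (zpow_ne_zero _ ha0) (Finset.prod_ne_zero_iff.mpr fun i _ =>
        mul_ne_zero (zpow_ne_zero _ (hne a i)) (zpow_ne_zero _ (hne _ i))))
  exact Prod.ext (funext fun i => sub_eq_zero.mp (congrFun key.1 i))
    (funext fun i => sub_eq_zero.mp (congrFun key.2 i))

/-- Conjugates of this quotient carry no power of `ζ`, so no slicing is needed. The exponents on the
two families are opposite, so each side has degree equal to the full weight of `W - W'`, at most `2
* m`. -/
theorem card_weightedBall_le_orderOf [Finite F] [Finite K] {m : ℕ} (hr : 2 * m + 2 ≤ r)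
    (hζ : ∀ P : F[X], P.natDegree ≤ r - 2 → aeval ζ P = 0 → P = 0)
    (hconj : HasPowerConjugates F ζ r) (ha : a ≠ 0) (ha' : a ≠ a⁻¹)
    (hγ : ζ + algebraMap F K a ≠ 0) (hγ' : algebraMap F K a * ζ + 1 ≠ 0)
    (hmono : StrictMono n) (hpos : ∀ i, 0 < n i) (hn : ∀ i, (n i : F) ≠ 0)
    (hk : ∀ i < k, n i ≤ m) :
    (weightedBall n k m).card ≤
      orderOf ((algebraMap F K a * ζ + 1) * (ζ + algebraMap F K a)⁻¹) := by
  have hγ0 : (algebraMap F K a * ζ + 1) * (ζ + algebraMap F K a)⁻¹ ≠ 0 :=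
    mul_ne_zero hγ' (inv_ne_zero hγ)
  have hk' : ∀ i : Fin k, n i ≤ r - 2 := fun i => (hk i i.2).trans (by omega)
  have hne (b : F) (i : Fin k) := pow_add_algebraMap_ne_zero hζ (hpos i) (hk' i) b
  have ha0 : algebraMap F K a ≠ 0 := (_root_.map_ne_zero _).mpr ha
  refine card_le_orderOf hγ0 _
    (fun W => ∏ i : Fin k, (algebraMap F K a *
      (ζ ^ n i + algebraMap F K a⁻¹) * (ζ ^ n i + algebraMap F K a)⁻¹) ^ W i)
    (fun W _ => exists_zpow_eq_prod_zpow hγ0 (fun i => ?_) W) ?_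
  · obtain ⟨σ, M, h1, h2, h3⟩ := hconj (n i)
      (Nat.not_dvd_of_pos_of_lt (hpos i) (by have := hk' i; omega))
    refine ⟨M, ?_⟩
    rw [zpow_natCast, ← h1, map_mul, map_inv₀, map_add, map_add, map_mul, h2, h3, map_one, mul_add,
      map_inv₀, mul_inv_cancel₀ ha0]
  intro W hW W' hW' h
  rw [Finset.mem_coe] at hW hW'
  simp only [mul_zpow, inv_zpow', Finset.prod_mul_distrib, prod_zpow_eq_zpow_sum ha0] at h
  have hd := sum_mul_toNat_sub_le_of_mem_weightedBall hpos hW hW'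
  have key := exponents_eq_zero_of_prod_zpow_eq_one (n := fun i : Fin k => n i)
    (u := fun i => -(W i - W' i)) (v := fun i => W i - W' i) (c := a ^ (∑ i, W i - ∑ i, W' i)) hζ ha
    (fun i j hij => Fin.ext (hmono.injective hij)) (fun i => hpos i) hk' (fun i => hn i)
    (fun h => absurd h ha') (zpow_ne_zero _ ha)
    (by simp only [add_comm (-_ : ℤ).toNat]; omega)
    (by simp only [neg_neg]; omega) (by
      have e : ∀ i : Fin k, (ζ ^ n i + algebraMap F K a) ^ (-(W i - W' i)) *
          (ζ ^ n i + algebraMap F K a⁻¹) ^ (W i - W' i) =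
          ((ζ ^ n i + algebraMap F K a⁻¹) ^ W i * (ζ ^ n i + algebraMap F K a) ^ (-W i)) /
          ((ζ ^ n i + algebraMap F K a⁻¹) ^ W' i * (ζ ^ n i + algebraMap F K a) ^ (-W' i)) :=
        fun i => by
          rw [show -(W i - W' i) = -W i - -W' i by ring, zpow_sub₀ (hne a i),
            zpow_sub₀ (hne a⁻¹ i), div_mul_div_comm, mul_comm (_ ^ (-W i)), mul_comm (_ ^ (-W' i))]
      rw [Finset.prod_congr rfl fun i _ => e i, Finset.prod_div_distrib, map_zpow₀,
        zpow_sub₀ ha0, div_mul_div_comm, Finset.prod_mul_distrib, Finset.prod_mul_distrib,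
        ← mul_assoc, ← mul_assoc, h, div_self]
      exact mul_ne_zero (mul_ne_zero (zpow_ne_zero _ ha0) (Finset.prod_ne_zero_iff.mpr fun i _ =>
        zpow_ne_zero _ (hne _ i))) (Finset.prod_ne_zero_iff.mpr fun i _ => zpow_ne_zero _ (hne _ i)))
  exact funext fun i => sub_eq_zero.mp (congrFun key.2 i)

end Orders

/-! ### Consequences of `q` being a primitive root mod `r`. -/

section Cyclotomic

open Polynomial

variable {F K : Type*} [Field F] [Finite F] [Field K] [Algebra F K] {p k q r : ℕ}

/-- Irreducible factors of `Φ_r` over `F` have degree the order of `q` mod `r`, here `r - 1`. -/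
theorem eq_zero_of_natDegree_le_of_isPrimitiveRoot (hp : p.Prime) (hq : q = p ^ k)
    (hr : r.Prime) (hrq : Nat.Coprime r q) (hk : 0 < k)
    (hprim : orderOf (q : ZMod r) = r - 1) (hF : Nat.card F = q) {ζ : K}
    (hζ : IsPrimitiveRoot ζ r) (P : F[X]) (hP : P.natDegree ≤ r - 2) (h0 : aeval ζ P = 0) :
    P = 0 := by
  cases nonempty_fintype F
  have : Fact p.Prime := ⟨hp⟩
  have hcard : Fintype.card F = p ^ k := by rw [← Nat.card_eq_fintype_card, hF, hq]
  have hpr : p.Coprime r := (Nat.Coprime.coprime_dvd_right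
    (by rw [hq]; exact dvd_pow_self p hk.ne') hrq).symm
  have hroot : aeval ζ (cyclotomic r F) = 0 := by
    rw [aeval_def, eval₂_eq_eval_map, map_cyclotomic]
    exact hζ.isRoot_cyclotomic hr.pos
  have hint : IsIntegral F ζ := ⟨cyclotomic r F, cyclotomic.monic r F, hroot⟩
  have hdeg := natDegree_of_dvd_cyclotomic_of_irreducible hcard hpr (minpoly.dvd F ζ hroot)
    (minpoly.irreducible hint)
  rw [← orderOf_units, ZMod.coe_unitOfCoprime, ← hq, hprim] at hdeg
  by_contra hne
  have := natDegree_le_of_dvd (minpoly.dvd F ζ h0) hne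
  have := hr.two_le
  omega

theorem exists_pow_modEq_of_orderOf_eq (hr : r.Prime) (hrq : Nat.Coprime r q)
    (hprim : orderOf (q : ZMod r) = r - 1) {j : ℕ} (hj : ¬ r ∣ j) : ∃ i : ℕ, q ^ i ≡ j [MOD r] := by
  have : Fact r.Prime := ⟨hr⟩
  have hjr : j.Coprime r := ((Nat.Prime.coprime_iff_not_dvd hr).mpr hj).symm
  set u := ZMod.unitOfCoprime q hrq.symm with hu
  have hou : orderOf u = r - 1 := by rw [← orderOf_units, ZMod.coe_unitOfCoprime, hprim]
  have htop : Subgroup.zpowers u = ⊤ := by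
    refine Subgroup.eq_top_of_card_eq _ ?_
    rw [Nat.card_zpowers, hou, Nat.card_eq_fintype_card, ZMod.card_units]
  have hmem : ZMod.unitOfCoprime j hjr ∈ Subgroup.zpowers u := htop ▸ Subgroup.mem_top _
  obtain ⟨i, hi⟩ := (mem_powers_iff_mem_zpowers.mpr hmem)
  refine ⟨i, ?_⟩
  have := congrArg Units.val hi
  simp only [Units.val_pow_eq_pow_val, hu, ZMod.coe_unitOfCoprime] at this
  rw [← ZMod.natCast_eq_natCast_iff]
  exact_mod_cast this

theorem exists_ringHom_eq_pow_card_pow (K : Type*) [Field K] [Algebra F K] (i : ℕ) :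
    ∃ σ : K →+* K, (∀ x, σ x = x ^ Nat.card F ^ i) ∧
      ∀ b : F, σ (algebraMap F K b) = algebraMap F K b := by
  cases nonempty_fintype F
  obtain ⟨p, hchar⟩ := CharP.exists F
  obtain ⟨d, hp, hcard⟩ := FiniteField.card F p
  have : Fact p.Prime := ⟨hp⟩
  have : CharP K p := charP_of_injective_algebraMap (algebraMap F K).injective p
  refine ⟨iterateFrobenius K p (d * i), fun x => ?_, fun b => ?_⟩
  · rw [iterateFrobenius_def, Nat.card_eq_fintype_card, hcard, pow_mul]
  · rw [iterateFrobenius_def, pow_mul, ← hcard, ← map_pow, FiniteField.pow_card_pow]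

theorem hasPowerConjugates_of_pow_eq_one (hr : r.Prime) (hrq : Nat.Coprime r q)
    (hprim : orderOf (q : ZMod r) = r - 1) (hF : Nat.card F = q) {ζ : K} (hζ : ζ ^ r = 1) :
    HasPowerConjugates F ζ r := by
  intro j hj
  obtain ⟨i, hi⟩ := exists_pow_modEq_of_orderOf_eq hr hrq hprim hj
  obtain ⟨σ, h1, h2⟩ := exists_ringHom_eq_pow_card_pow (F := F) K i
  refine ⟨σ, _, h1, h2, ?_⟩
  rw [h1, hF, pow_eq_pow_mod _ hζ, hi, ← pow_eq_pow_mod _ hζ]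

theorem natCast_nonMultiple_ne_zero (hp : p.Prime) (hq : q = p ^ k) (hF : Nat.card F = q) (i : ℕ) :
    (nonMultiple p i : F) ≠ 0 := by
  cases nonempty_fintype F
  have : Fact p.Prime := ⟨hp⟩
  have : CharP F p := charP_of_card_eq_prime_pow (f := k)
    (by rw [← Nat.card_eq_fintype_card, hF, hq])
  rw [Ne, CharP.cast_eq_zero_iff F p]
  exact not_dvd_nonMultiple hp.two_le i

theorem pow_half_eq_neg_one (hr : r.Prime) (hodd : Odd r)
    (hprim : orderOf (q : ZMod r) = r - 1) : (q : ZMod r) ^ ((r - 1) / 2) = -1 := by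
  have : Fact r.Prime := ⟨hr⟩
  have hr2 := hr.two_le
  obtain ⟨m, hm⟩ := hodd
  have h2 : (r - 1) / 2 = m := by omega
  have h3 : (q : ZMod r) ^ m * (q : ZMod r) ^ m = 1 := by
    rw [← pow_add, show m + m = r - 1 by omega, ← hprim, pow_orderOf_eq_one]
  rw [h2]
  refine (mul_self_eq_one_iff.mp h3).resolve_left fun h1 => ?_
  have := Nat.le_of_dvd (by omega) (orderOf_dvd_of_pow_eq_one h1)
  omega

end Cyclotomic

/-! ### Elements of coprime order. -/

theorem orderOf_le_two_mul_orderOf_sq {G : Type*} [Monoid G] (x : G) :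
    orderOf x ≤ 2 * orderOf (x ^ 2) := by
  rw [orderOf_pow' x two_ne_zero]
  have h1 : (orderOf x).gcd 2 ∣ 2 := Nat.gcd_dvd_right _ _
  have h2 := Nat.le_of_dvd two_pos h1
  calc orderOf x = (orderOf x).gcd 2 * (orderOf x / (orderOf x).gcd 2) :=
        (Nat.mul_div_cancel' (Nat.gcd_dvd_left _ _)).symm
    _ ≤ _ := Nat.mul_le_mul_right _ h2

theorem exists_odd_of_rhoTwo_eq_two {n : ℕ} (h : rhoTwo n = 2) : ∃ d, Odd d ∧ n = 2 * d := by
  unfold rhoTwo at h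
  have h1 : padicValInt 2 n = 1 := Nat.pow_right_injective le_rfl (by simpa using h)
  rw [padicValInt.of_nat] at h1
  have hn : n ≠ 0 := by rintro rfl; simp at h1
  obtain ⟨d, hd⟩ : 2 ∣ n := dvd_of_one_le_padicValNat h1.ge
  refine ⟨d, ?_, hd⟩
  rw [← Nat.not_even_iff_odd, even_iff_two_dvd]
  intro h2
  have : 2 ^ 2 ∣ n := by rw [hd, sq]; exact Nat.mul_dvd_mul_left 2 h2
  rw [padicValNat_dvd_iff_le hn] at this
  omega

/-- If `x ^ (N - 1) = 1 = y ^ (N + 1)`, the product of `x` and `y`, one of them squared so that the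
orders become coprime, has order at least half the product of the orders of `x` and `y`. -/
theorem orderOf_mul_orderOf_le {G : Type*} [CommMonoid G] {x y z : G} {N : ℕ} (hN : 1 ≤ N)
    (hx : x ^ (N - 1) = 1) (hy : y ^ (N + 1) = 1)
    (hz : (rhoTwo ((N : ℤ) - 1) = 2 ∧ z = x ^ 2 * y) ∨ (rhoTwo ((N : ℤ) + 1) = 2 ∧ z = x * y ^ 2)) :
    orderOf x * orderOf y ≤ 2 * orderOf z := by
  -- With `2 * d` and `e` equal to `N - 1` and `N + 1` in either order, a common divisor of `d` and
  -- `e` divides `2`, and `d` is odd.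
  have key : ∀ d e : ℕ, Odd d → (2 * d = e + 2 ∨ e = 2 * d + 2) → d.Coprime e := by
    intro d e hd he
    have h2 : d.gcd e ∣ 2 := by
      have h1 := Nat.gcd_dvd_left d e
      have h2 := Nat.gcd_dvd_right d e
      rcases he with he | he
      · exact (Nat.dvd_add_right h2).mp (he ▸ h1.mul_left 2)
      · exact (Nat.dvd_add_right (h1.mul_left 2)).mp (he ▸ h2)
    rcases (Nat.dvd_prime Nat.prime_two).mp h2 with h | h
    · exact h
    · have : 2 ∣ d := h ▸ Nat.gcd_dvd_left d e
      exact absurd (even_iff_two_dvd.mpr this) (Nat.not_even_iff_odd.mpr hd)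
  rcases hz with ⟨hρ, rfl⟩ | ⟨hρ, rfl⟩
  · have e : (N : ℤ) - 1 = (N - 1 : ℕ) := by push_cast [hN]; ring
    rw [e] at hρ
    obtain ⟨d, hd, hNd⟩ := exists_odd_of_rhoTwo_eq_two hρ
    have h1 : orderOf (x ^ 2) ∣ d := orderOf_dvd_of_pow_eq_one (by rw [← pow_mul, ← hNd, hx])
    have h2 : orderOf y ∣ N + 1 := orderOf_dvd_of_pow_eq_one hy
    rw [(Commute.all (x ^ 2) y).orderOf_mul_eq_mul_orderOf_of_coprime
      (((key d (N + 1) hd (by omega)).coprime_dvd_left h1).coprime_dvd_right h2), ← mul_assoc]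
    exact Nat.mul_le_mul_right _ (orderOf_le_two_mul_orderOf_sq x)
  · have e : (N : ℤ) + 1 = (N + 1 : ℕ) := by push_cast; ring
    rw [e] at hρ
    obtain ⟨d, hd, hNd⟩ := exists_odd_of_rhoTwo_eq_two hρ
    have h1 : orderOf (y ^ 2) ∣ d := orderOf_dvd_of_pow_eq_one (by rw [← pow_mul, ← hNd, hy])
    have h2 : orderOf x ∣ N - 1 := orderOf_dvd_of_pow_eq_one hx
    rw [(Commute.all x (y ^ 2)).orderOf_mul_eq_mul_orderOf_of_coprime
      (((key d (N - 1) hd (by omega)).coprime_dvd_left h1).coprime_dvd_right h2).symm]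
    calc _ ≤ orderOf x * (2 * orderOf (y ^ 2)) :=
          Nat.mul_le_mul_left _ (orderOf_le_two_mul_orderOf_sq y)
      _ = _ := by ring

/-! ### Assembly of the three bounds. -/

theorem corollary4
    (p k q r : ℕ) (hp : p.Prime) (hk : 0 < k) (hq : q = p ^ k)
    (hr : r.Prime) (hodd : Odd r) (hrq : Nat.Coprime r q)
    (hprim : orderOf (q : ZMod r) = r - 1)
    (hlarge : (r : ℤ) - 3 ≥ 2 * (p : ℤ) ^ 2)
    {F K : Type*} [Field F] [Finite F] (hF : Nat.card F = q)
    [Field K] [Algebra F K] (θ : K)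
    (hroot : Polynomial.aeval θ (Polynomial.cyclotomic r F) = 0)
    (hgen : IntermediateField.adjoin F {θ} = ⊤)
    (e f : ℤ) (hf : IsCoprime f (r : ℤ)) (a : F) (ha : a ≠ 0) :
    ((orderOf (θ ^ e * (θ ^ f + algebraMap F K a)) : ℝ) >
        ((p : ℝ) * ((p : ℝ) - 1) / (160 * ((r : ℝ) - 2))) ^ Real.sqrt (p : ℝ) *
          Real.exp (2.5 * Real.sqrt ((1 - 1 / (p : ℝ)) * ((r : ℝ) - 2)))) ∧
    (a ≠ 1 → a ≠ -1 →
      (orderOf (θ ^ e * (θ ^ f + algebraMap F K a)) : ℝ) >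
        1 / 2 * ((p : ℝ) * ((p : ℝ) - 1) / (80 * ((r : ℝ) - 3))) ^ (2 * Real.sqrt (p : ℝ)) *
          Real.exp (2.5 * Real.sqrt 2 * Real.sqrt ((1 - 1 / (p : ℝ)) * ((r : ℝ) - 3)))) ∧
    (a ≠ 1 → a ≠ -1 →
      ∀ z : K,
        ((rhoTwo ((q : ℤ) ^ ((r - 1) / 2) - 1) = 2 ∧
            z = (θ + θ⁻¹) ^ 2 *
              ((algebraMap F K a * θ + 1) * (θ + algebraMap F K a)⁻¹)) ∨
          (rhoTwo ((q : ℤ) ^ ((r - 1) / 2) + 1) = 2 ∧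
            z = (θ + θ⁻¹) *
              ((algebraMap F K a * θ + 1) * (θ + algebraMap F K a)⁻¹) ^ 2)) →
        (orderOf z : ℝ) >
          1 / 2 * ((p : ℝ) * ((p : ℝ) - 1) / (80 * ((r : ℝ) - 3))) ^ Real.sqrt (p : ℝ) *
            Real.exp (2.5 * (1 + Real.sqrt 2 / 2) *
              Real.sqrt ((1 - 1 / (p : ℝ)) * ((r : ℝ) - 3)))) := by
  have hr2 := hr.two_le
  have hp2 := hp.two_le
  have hlarge' : 2 * p ^ 2 + 3 ≤ r := by zify; linarith
  obtain ⟨m, hm⟩ : ∃ m, r = 2 * m + 3 := by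
    obtain ⟨t, ht⟩ := hodd
    exact ⟨t - 1, by omega⟩
  have hpm : p ^ 2 ≤ m := by omega
  have hp4 : 4 ≤ p ^ 2 := by nlinarith
  have hrF : (r : F) ≠ 0 := by
    cases nonempty_fintype F
    have : Fact p.Prime := ⟨hp⟩
    have : CharP F p := charP_of_card_eq_prime_pow (f := k)
      (by rw [← Nat.card_eq_fintype_card, hF, hq])
    rw [Ne, CharP.cast_eq_zero_iff F p]
    intro hpr
    have h1 := Nat.dvd_gcd hpr (hq ▸ dvd_pow_self p hk.ne')
    rw [Nat.Coprime.gcd_eq_one hrq] at h1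
    exact hp.one_lt.ne' (Nat.dvd_one.mp h1)
  have : NeZero (r : K) := ⟨by
    rw [← map_natCast (algebraMap F K)]; exact (map_ne_zero _).mpr hrF⟩
  have hθ : IsPrimitiveRoot θ r := by
    rw [Polynomial.aeval_def, Polynomial.eval₂_eq_eval_map, Polynomial.map_cyclotomic] at hroot
    exact Polynomial.isRoot_cyclotomic_iff.mp hroot
  have hint : IsIntegral F θ :=
    ⟨Polynomial.cyclotomic r F, Polynomial.cyclotomic.monic r F, hroot⟩
  have hfin : Finite K := by
    have h1 : FiniteDimensional F (IntermediateField.adjoin F {θ}) :=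
      IntermediateField.adjoin.finiteDimensional hint
    rw [hgen] at h1
    have : FiniteDimensional F K :=
      Module.Finite.equiv (IntermediateField.topEquiv (F := F) (E := K)).toLinearEquiv
    exact Module.finite_of_finite F
  have hn := natCast_nonMultiple_ne_zero hp hq hF
  have hmono := nonMultiple_strictMono p
  have hpos := nonMultiple_pos p
  have hdeg {ζ : K} (hζ : IsPrimitiveRoot ζ r) :=
    eq_zero_of_natDegree_le_of_isPrimitiveRoot hp hq hr hrq hk hprim hF hζ
  have hconj {ζ : K} (hζ : IsPrimitiveRoot ζ r) :=
    hasPowerConjugates_of_pow_eq_one hr hrq hprim hF hζ.pow_eq_one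
  have hadd {ζ : K} (hζ : IsPrimitiveRoot ζ r) (b : F) : ζ + algebraMap F K b ≠ 0 := by
    have := pow_add_algebraMap_ne_zero (hdeg hζ) one_pos (by omega) b
    rwa [pow_one] at this
  have hθ0 : θ ≠ 0 := hθ.ne_zero hr.ne_zero
  -- `θ ^ e` is a power of the primitive root `θ ^ f`
  have hbase (e f : ℤ) (hf : IsCoprime f (r : ℤ)) :
      IsPrimitiveRoot (θ ^ f) r ∧ ∃ E : ℤ, θ ^ e = (θ ^ f) ^ E := by
    refine ⟨hθ.zpow_of_gcd_eq_one f (Int.isCoprime_iff_gcd_eq_one.mp hf), ?_⟩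
    obtain ⟨x, y, hxy⟩ := hf
    refine ⟨x * e, ?_⟩
    have h1 : e = f * (x * e) + r * (y * e) := by linear_combination (-e) * hxy
    nth_rewrite 1 [h1]
    rw [zpow_add₀ hθ0, zpow_mul, zpow_mul θ (r : ℤ), zpow_natCast, hθ.pow_eq_one, one_zpow, mul_one]
  have hslice (e f : ℤ) (hf : IsCoprime f (r : ℤ)) {b : F} (hb : b ≠ 0) {k : ℕ} {s : ℤ}
      (hk : ∀ i < k, nonMultiple p i ≤ r - 2) :
      (weightedSlice (nonMultiple p) k (r - 2) s).card ≤
        orderOf (θ ^ e * (θ ^ f + algebraMap F K b)) := by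
    obtain ⟨hζ, E, hE⟩ := hbase e f hf
    rw [hE]
    exact card_weightedSlice_le_orderOf hr2 (hdeg hζ) (hζ.ne_zero hr.ne_zero) (hconj hζ) hb
      (hadd hζ b) hmono hpos hn hk s E
  have hr2' : ((r - 2 : ℕ) : ℝ) = (r : ℝ) - 2 := by push_cast [hr2]; ring
  have hm' : (r : ℝ) - 3 = 2 * m := by rw [hm]; push_cast; ring
  have hpR : (2 : ℝ) ≤ p := by exact_mod_cast hp2
  have hself (h1 : a ≠ 1) (h2 : a ≠ -1) : a ≠ a⁻¹ := by
    intro h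
    have h3 : a * a = 1 := by nth_rewrite 2 [h]; exact mul_inv_cancel₀ ha
    exact (mul_self_eq_one_iff.mp h3).elim h1 h2
  refine ⟨?_, fun ha1 ha2 => ?_, fun ha1 ha2 z hz => ?_⟩
  · obtain ⟨k, s, hk, hlt⟩ := exists_card_weightedSlice_gt hp2 (m := r - 2) (by omega)
    refine lt_of_eq_of_lt ?_ (hlt.trans_le (Nat.cast_le.mpr (hslice e f hf ha hk)))
    rw [hr2', show (1 - 1 / (p : ℝ)) * (2 * ((r : ℝ) - 2)) = 2 * ((1 - 1 / (p : ℝ)) * ((r : ℝ) - 2))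
      by ring, Real.sqrt_mul (by norm_num : (0 : ℝ) ≤ 2)]
    congr 2
    have := Real.mul_self_sqrt (show (0 : ℝ) ≤ 2 by norm_num)
    linear_combination (-1.25 * Real.sqrt ((1 - 1 / (p : ℝ)) * ((r : ℝ) - 2))) * this
  · obtain ⟨k, s, hk, hlt⟩ := exists_card_weightedSlice_gt hp2 hpm
    obtain ⟨hζ, E, hE⟩ := hbase e f hf
    have h1 := card_weightedSlice_sq_le_orderOf (m := m) (by omega) (hdeg hζ)
      (hζ.ne_zero hr.ne_zero) hζ.pow_eq_one (hconj hζ) ha (hself ha1 ha2) (hadd hζ a) hmono hpos hn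
      hk s E
    rw [← hE] at h1
    refine lt_of_lt_of_le ?_ (Nat.cast_le.mpr h1)
    push_cast
    have hs0 : (0 : ℝ) < p * (p - 1) / (160 * m) := by
      have : (0 : ℝ) < m := by exact_mod_cast (show 0 < m by omega)
      have : (0 : ℝ) < p - 1 := by linarith
      positivity
    rw [hm', show (80 : ℝ) * (2 * m) = 160 * m by ring, mul_comm 2 (Real.sqrt p),
      Real.rpow_mul hs0.le, Real.rpow_two]
    have hP := Real.rpow_pos_of_pos hs0 (Real.sqrt p)
    set P := ((p : ℝ) * (p - 1) / (160 * m)) ^ Real.sqrt p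
    set w := Real.sqrt ((1 - 1 / (p : ℝ)) * (2 * m))
    have hexp : Real.exp (2.5 * Real.sqrt 2 * w) = Real.exp (1.25 * Real.sqrt 2 * w) ^ 2 := by
      rw [← Real.exp_nat_mul]; congr 1; push_cast; ring
    rw [hexp]
    have h2 := Real.exp_pos (1.25 * Real.sqrt 2 * w)
    have h3 := pow_lt_pow_left₀ hlt (by positivity) two_ne_zero
    rw [mul_pow] at h3
    have h4 : 0 < P ^ 2 * Real.exp (1.25 * Real.sqrt 2 * w) ^ 2 := by positivity
    linarith
  · set N := q ^ ((r - 1) / 2) with hN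
    have hN1 : 1 ≤ N := Nat.one_le_pow _ _ (hq ▸ pow_pos hp.pos _)
    -- For `p = 2` both `N - 1` and `N + 1` are odd, so neither case for `z` can occur.
    have hp3 : 3 ≤ p := by
      rcases hp.eq_two_or_odd with h | h
      · exfalso
        have hN2 : Even N := by
          rw [hN, hq, h]
          exact ((even_two.pow_of_ne_zero hk.ne').pow_of_ne_zero (by omega))
        rcases hz with ⟨h3, -⟩ | ⟨h3, -⟩
        · have e : (q : ℤ) ^ ((r - 1) / 2) - 1 = (N - 1 : ℕ) := by
            rw [Nat.cast_sub hN1, hN]; push_cast; rfl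
          rw [e] at h3
          obtain ⟨d, -, hd⟩ := exists_odd_of_rhoTwo_eq_two h3
          obtain ⟨t, ht⟩ := hN2
          omega
        · have e : (q : ℤ) ^ ((r - 1) / 2) + 1 = (N + 1 : ℕ) := by push_cast [hN]; ring
          rw [e] at h3
          obtain ⟨d, -, hd⟩ := exists_odd_of_rhoTwo_eq_two h3
          obtain ⟨t, ht⟩ := hN2
          omega
      · omega
    obtain ⟨k₁, k₂, s, hk₁, hk₂, hlt⟩ :=
      exists_card_weightedSlice_mul_card_weightedBall_gt hp3 hpm
    rw [show 2 * m + 1 = r - 2 by omega] at hlt hk₁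
    have hNr : θ ^ (N + 1) = 1 := by
      have : ((N + 1 : ℕ) : ZMod r) = 0 := by
        rw [hN]; push_cast; rw [pow_half_eq_neg_one hr hodd hprim]; ring
      exact (hθ.pow_eq_one_iff_dvd _).mpr ((ZMod.natCast_eq_zero_iff _ _).mp this)
    have hθN : θ ^ N = θ⁻¹ := eq_inv_of_mul_eq_one_left (by rw [← pow_succ, hNr])
    obtain ⟨σ, hσ, hσF⟩ := exists_ringHom_eq_pow_card_pow (F := F) K ((r - 1) / 2)
    rw [hF, ← hN] at hσ
    have hσθ : σ θ = θ⁻¹ := by rw [hσ, hθN]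
    have ha0 : algebraMap F K a ≠ 0 := (map_ne_zero _).mpr ha
    have hden : θ + algebraMap F K a ≠ 0 := hadd hθ a
    have hnum : algebraMap F K a * θ + 1 ≠ 0 := by
      have h1 := mul_ne_zero ha0 (hadd hθ a⁻¹)
      rwa [mul_add, map_inv₀, mul_inv_cancel₀ ha0] at h1
    -- This is an element of the type in (a), with `e = -1`, `f = 2`, `a = 1`.
    have hx : θ + θ⁻¹ = θ ^ (-1 : ℤ) * (θ ^ (2 : ℤ) + algebraMap F K 1) := by
      rw [map_one, zpow_neg_one, zpow_ofNat]
      field_simp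
    have h2r : IsCoprime (2 : ℤ) r := by
      rw [hm]; push_cast
      exact ⟨-(m + 1), 1, by ring⟩
    have hx0 : θ + θ⁻¹ ≠ 0 := by
      rw [hx]
      exact mul_ne_zero (zpow_ne_zero _ hθ0) (hadd (hbase 0 2 h2r).1 1)
    -- The `N`-th power map inverts `θ`, hence fixes `θ + θ⁻¹`.
    have hxN : (θ + θ⁻¹) ^ (N - 1) = 1 := by
      have h1 : (θ + θ⁻¹) ^ N = θ + θ⁻¹ := by
        rw [← hσ, map_add, map_inv₀, hσθ, inv_inv, add_comm]
      refine mul_right_cancel₀ hx0 ?_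
      rw [← pow_succ, Nat.sub_add_cancel hN1, h1, one_mul]
    -- The same map inverts this quotient, by replacing `θ` with `θ⁻¹`.
    have hyN : ((algebraMap F K a * θ + 1) * (θ + algebraMap F K a)⁻¹) ^ (N + 1) = 1 := by
      rw [pow_succ, ← hσ, map_mul, map_inv₀, map_add, map_add, map_mul, hσF, hσθ, map_one]
      have h1 : θ⁻¹ + algebraMap F K a = θ⁻¹ * (algebraMap F K a * θ + 1) := by
        field_simp
        ring
      have h2 : algebraMap F K a * θ⁻¹ + 1 = θ⁻¹ * (θ + algebraMap F K a) := by
        field_simp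
        ring
      rw [mul_comm] at hnum
      rw [h1, h2, mul_comm _ θ]
      field_simp
    have hz' := orderOf_mul_orderOf_le hN1 hxN hyN (z := z) (by rw [hN]; push_cast; exact hz)
    have hS := hslice (-1) 2 h2r one_ne_zero hk₁ (s := s)
    rw [← hx] at hS
    have hB := card_weightedBall_le_orderOf (m := m) (by omega) (hdeg hθ) (hconj hθ) ha
      (hself ha1 ha2) hden hnum hmono hpos hn hk₂
    have hfinal : ((weightedSlice (nonMultiple p) k₁ (r - 2) s).card : ℝ) *
        (weightedBall (nonMultiple p) k₂ m).card ≤ 2 * orderOf z := by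
      exact_mod_cast (Nat.mul_le_mul hS hB).trans hz'
    rw [hm', show (80 : ℝ) * (2 * m) = 160 * m by ring]
    linarith
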